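/- Let $n\ge 0$ and $T\ge 2$. Let $\bm\xi=(\Phi,\Theta,\Sigma_\epsilon)$ consist of real $n\times n$ matrices with $\Sigma_\epsilon$ symmetric positive definite, and put $\Phi(z)=I_n-\Phi z$, $\Theta(z)=I_n+\Theta z$. Assume (causality and invertibility) $\det\Phi(z)\ne0$ and $\det\Theta(z)\neq 0$ for all $z\in\mathbb C$ with $|z|\le 1$; (symmetric covariance) $\Phi(z)^{-1}\Theta(z)\Sigma_\epsilon\Theta(z^{-1})^\top(\Phi(z^{-1})^{\top})^{-1}=\Phi(z^{-1})^{-1}\Theta(z^{-1})\Sigma_\epsilon\Theta(z)^\top(\Phi(z)^{\top})^{-1}$ for all $z\in\mathbb C$ with $|z|=1$. Let $\{Y_t\}_{t\in\mathbb Z}$ be a zero-mean, square-integrable, weakly stationary VARMA(1,1) process with parameter $\bm\xi$: $Y_t-\Phi Y_{t-1}=\epsilon_t+\Theta\epsilon_{t-1}$ almost surely for every $t$, with $\{\epsilon_t\}$ i.i.d. $\mathcal N(0,\Sigma_\epsilon)$. Write $\bm Y=(Y_1,\dots,Y_T)$ and define $W_t=Y_t-\Phi Y_{t+1}$ for $1\le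 t\le T-1$ and $W_T=Y_T$. Let $\hat W_t$ be the one-step predictor of $W_t$, i.e. the mean-square orthogonal projection (componentwise) of $W_t$ onto the linear span of the components of $W_1,\dots,W_{t-1}$, and let $R_t=W_t-\hat W_t$ be the innovations. Let $\Gamma_Y(0)=\sum_{j\ge0}\Psi_j\Sigma_\epsilon\Psi_j^\top$ with $\Psi_0=I_n$, $\Psi_{j}=\Phi^{j-1}(\Phi+\Theta)$ for $j\ge1$. Define recursively $\Theta_{t,1}=\Sigma_\epsilon\Theta^\top\Sigma_t^{-1}$ for $1\le t\le T-1$, and $$\Sigma_1=\Theta\Sigma_\epsilon\Theta^\top+\Sigma_\epsilon,\qquad \Sigma_t=\Theta\Sigma_\epsilon\Theta^\top+\Sigma_\epsilon-\Theta_{t-1,1}\Sigma_{t-1}\Theta_{t-1,1}^\top\ (2\le t\le T-1),\qquad \Sigma_T=\Gamma_Y(0)-\Theta_{T-1,1}\Sigma_{T-1}\Theta_{T-1,1}^\top .$$ Define also $\alpha_1=Y_1$, $\alpha_t=Y_t-\Theta_{t-1,1}\alpha_{t-1}$ for $2\le t\le T$; $\beta_t=Y_{t+1}$ for $1\le t\le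 T-1$; and $C_{j,t}=(-1)^{2t-j}\,\Theta_{t-1,1}\Theta_{t-2,1}\cdots\Theta_{t-j-1,1}$ for $2\le t\le T-1$, $0\le j\le t-2$. Then the following hold. 1. $\mathbb E[Y_tY_t^\top]=\Gamma_Y(0)$ for all $t$. Each $\Sigma_t$ ($1\le t\le T$) is positive definite and equals $\mathbb E[R_tR_t^\top]$. Almost surely $\hat W_1=0$, $\hat W_t=\Theta_{t-1,1}R_{t-1}$ for $2\le t\le T$, and the innovations are $$R_1=\alpha_1-\Phi\beta_1,\qquad R_t=\alpha_t-\Phi\beta_t+\sum_{j=0}^{t-2}C_{j,t}\Phi\beta_{t-1-j}\quad(2\le t\le T-1),$$ $$R_T=\alpha_T+\Theta_{T-1,1}\Phi\beta_{T-1}-\Theta_{T-1,1}\sum_{j=0}^{T-3}C_{j,T-1}\Phi\beta_{T-2-j}.$$ 2. Let $\hat{\bm\xi}(\bm Y)=\big((Y_tY_{t-j}^\top)_{j=0}^{t-1}\big)_{t=1}^T$. There is a function $h(\cdot,\cdot)$ of the statistic and the parameter, measurable in the statistic, with $h(\hat{\bm\xi}(\bm Y),\bm\xi)=\sum_{t=1}^TR_t^\top\Sigma_t^{-1}R_t$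 (with $R_t$ given by the formulas above), such that $\bm Y$ has Lebesgue density (likelihood) $$L(\bm Y;\bm\xi)=g_0(\bm Y)\,g_1(\hat{\bm\xi}(\bm Y),\bm\xi),\qquad g_0(\bm Y)=(2\pi)^{-nT/2},\qquad g_1(\hat{\bm\xi},\bm\xi)=\Big(\prod_{t=1}^T\det\Sigma_t\Big)^{-1/2}\exp\Big\{-\tfrac12h(\hat{\bm\xi},\bm\xi)\Big\}.$$ The function $h$ does not depend on the process. 3. $\hat{\bm\xi}$ is a sufficient statistic for $\bm\xi$: the conditional distribution of $\bm Y$ given $\hat{\bm\xi}(\bm Y)$ can be chosen as one Markov kernel that is the same for all parameters $\bm\xi$ satisfying the assumptions above. -/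

import Mathlib

open MeasureTheory ProbabilityTheory Matrix

universe u

noncomputable section

namespace VARMA

/-- The parameters `ξ = (Φ, Θ, Σ_ε)` of an `n`-dimensional VARMA(1,1) process. -/
structure Param (n : ℕ) where
  Phi : Matrix (Fin n) (Fin n) ℝ
  Theta : Matrix (Fin n) (Fin n) ℝ
  SigmaEps : Matrix (Fin n) (Fin n) ℝ

variable {n : ℕ}

/-- `Φ(z) = I - z Φ`. -/
def Param.phiPoly (ξ : Param n) (z : ℂ) : Matrix (Fin n) (Fin n) ℂ :=
  1 - z • ξ.Phi.map Complex.ofReal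

/-- `Θ(z) = I + z Θ`. -/
def Param.thetaPoly (ξ : Param n) (z : ℂ) : Matrix (Fin n) (Fin n) ℂ :=
  1 + z • ξ.Theta.map Complex.ofReal

/-- Causality and invertibility. -/
def Param.CausalInvertible (ξ : Param n) : Prop :=
  ∀ z : ℂ, ‖z‖ ≤ 1 → (ξ.phiPoly z).det ≠ 0 ∧ (ξ.thetaPoly z).det ≠ 0

/-- Symmetric covariance:
`Φ(z)⁻¹ Θ(z) Σ_ε Θ(z⁻¹)ᵀ Φ(z⁻¹)ᵀ⁻¹` is invariant under `z ↦ z⁻¹` on the unit circle. -/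
def Param.SymmetricCovariance (ξ : Param n) : Prop :=
  ∀ z : ℂ, ‖z‖ = 1 →
    (ξ.phiPoly z)⁻¹ * ξ.thetaPoly z * ξ.SigmaEps.map Complex.ofReal *
        (ξ.thetaPoly z⁻¹)ᵀ * ((ξ.phiPoly z⁻¹)ᵀ)⁻¹ =
      (ξ.phiPoly z⁻¹)⁻¹ * ξ.thetaPoly z⁻¹ * ξ.SigmaEps.map Complex.ofReal *
        (ξ.thetaPoly z)ᵀ * ((ξ.phiPoly z)ᵀ)⁻¹

/-- Admissible parameters: the noise covariance is a (nondegenerate) covariance matrix, and the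
process is causal, invertible and has symmetric covariance. -/
structure Param.Admissible (ξ : Param n) : Prop where
  posDef : ξ.SigmaEps.PosDef
  causalInvertible : ξ.CausalInvertible
  symmetricCovariance : ξ.SymmetricCovariance

/-- `Y` is a zero-mean (weakly) stationary VARMA(1,1) process with parameters `ξ`, driven by the
i.i.d. Gaussian innovations `ε_t ∼ N(0, Σ_ε)`:
`Y_t - Φ Y_{t-1} = ε_t + Θ ε_{t-1}` for every integer `t`. -/
structure IsProcess {Ω : Type u} [MeasurableSpace Ω] (P : Measure Ω) (ξ : Param n)
    (Y ε : ℤ → Ω → Fin n → ℝ) : Prop where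
  measurable_noise : ∀ t, Measurable (ε t)
  indep_noise : iIndepFun ε P
  law_noise : ∀ t, P.map (fun ω => WithLp.toLp 2 (ε t ω)) = multivariateGaussian 0 ξ.SigmaEps
  measurable : ∀ t, Measurable (Y t)
  memLp : ∀ t, MemLp (Y t) 2 P
  mean_zero : ∀ t i, ∫ ω, Y t ω i ∂P = 0
  stationary : ∀ s t h : ℤ, ∀ i j,
    ∫ ω, Y (s + h) ω i * Y s ω j ∂P = ∫ ω, Y (t + h) ω i * Y t ω j ∂P
  equation : ∀ t, ∀ᵐ ω ∂P,
    Y t ω - ξ.Phi *ᵥ Y (t - 1) ω = ε t ω + ξ.Theta *ᵥ ε (t - 1) ω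

/-- A data set: a realization of length `T`. The index `k : Fin T` stands for the time `k + 1`. -/
abbrev Data (n T : ℕ) : Type := Fin T → Fin n → ℝ

/-- The data set `(Y_1, …, Y_T)` of a process. -/
def sample {Ω : Type u} (T : ℕ) (Y : ℤ → Ω → Fin n → ℝ) (ω : Ω) : Data n T :=
  fun k => Y ((k : ℤ) + 1) ω

/-- The observation `y_t` at time `t ∈ {1, …, T}` (and `0` at all other times). -/
def obs {T : ℕ} (y : Data n T) (t : ℕ) : Fin n → ℝ :=
  if h : 1 ≤ t ∧ t ≤ T then y ⟨t - 1, by omega⟩ else 0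

/-- Coefficients of the causal representation `Y_t = ∑ j, Ψ_j ε_{t-j}`. -/
def Param.psi (ξ : Param n) : ℕ → Matrix (Fin n) (Fin n) ℝ
  | 0 => 1
  | j + 1 => ξ.Phi ^ j * (ξ.Phi + ξ.Theta)

/-- The stationary lag-zero covariance `Γ_Y(0)` as a function of the parameters. -/
def Param.gammaY (ξ : Param n) : Matrix (Fin n) (Fin n) ℝ :=
  ∑' j, ξ.psi j * ξ.SigmaEps * (ξ.psi j)ᵀ

/-- The forward transformed process: `W_t = Y_t - Φ Y_{t+1}` for `t < T` and `W_T = Y_T`. -/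
def forward {T : ℕ} (ξ : Param n) (y : Data n T) (t : ℕ) : Fin n → ℝ :=
  if t < T then obs y t - ξ.Phi *ᵥ obs y (t + 1) else obs y t

/-- The recursion for `Σ_t`, `t ∈ {1, …, T}`, with `Θ_{t-1,1} = Σ_ε Θᵀ Σ_{t-1}⁻¹` inlined
(the value at `t = 0` is not used). -/
def Param.predCov (ξ : Param n) (T : ℕ) : ℕ → Matrix (Fin n) (Fin n) ℝ
  | 0 => 0
  | 1 => ξ.Theta * ξ.SigmaEps * ξ.Thetaᵀ + ξ.SigmaEps
  | t + 2 =>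
    (if t + 2 = T then ξ.gammaY else ξ.Theta * ξ.SigmaEps * ξ.Thetaᵀ + ξ.SigmaEps) -
      (ξ.SigmaEps * ξ.Thetaᵀ * (ξ.predCov T (t + 1))⁻¹) * ξ.predCov T (t + 1) *
        (ξ.SigmaEps * ξ.Thetaᵀ * (ξ.predCov T (t + 1))⁻¹)ᵀ

/-- `Θ_{t,1} = Σ_ε Θᵀ Σ_t⁻¹`. -/
def Param.coef (ξ : Param n) (T t : ℕ) : Matrix (Fin n) (Fin n) ℝ :=
  ξ.SigmaEps * ξ.Thetaᵀ * (ξ.predCov T t)⁻¹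

/-- `α_1 = Y_1`, `α_t = Y_t - Θ_{t-1,1} α_{t-1}` (the value at `t = 0` is not used). -/
def alpha {T : ℕ} (ξ : Param n) (y : Data n T) : ℕ → Fin n → ℝ
  | 0 => 0
  | 1 => obs y 1
  | t + 2 => obs y (t + 2) - ξ.coef T (t + 1) *ᵥ alpha ξ y (t + 1)

/-- `β_t = Y_{t+1}`. -/
def beta {T : ℕ} (y : Data n T) (t : ℕ) : Fin n → ℝ := obs y (t + 1)

/-- `C_{j,t} = (-1)^{2t-j} Θ_{t-1,1} Θ_{t-2,1} ⋯ Θ_{t-j-1,1}`. -/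
def Param.C (ξ : Param n) (T j t : ℕ) : Matrix (Fin n) (Fin n) ℝ :=
  (-1 : ℝ) ^ (2 * t - j) • ((List.range (j + 1)).map fun k => ξ.coef T (t - 1 - k)).prod

/-- The explicit formula for the innovations `R_t`, `t ∈ {1, …, T}`. -/
def innov {T : ℕ} (ξ : Param n) (y : Data n T) (t : ℕ) : Fin n → ℝ :=
  if t = 1 then alpha ξ y 1 - ξ.Phi *ᵥ beta y 1
  else if t < T then
    alpha ξ y t - ξ.Phi *ᵥ beta y t +
      ∑ j ∈ Finset.range (t - 1), ξ.C T j t *ᵥ (ξ.Phi *ᵥ beta y (t - 1 - j))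
  else
    alpha ξ y T + ξ.coef T (T - 1) *ᵥ (ξ.Phi *ᵥ beta y (T - 1)) -
      ξ.coef T (T - 1) *ᵥ
        ∑ j ∈ Finset.range (T - 2), ξ.C T j (T - 1) *ᵥ (ξ.Phi *ᵥ beta y (T - 2 - j))

/-- The recursive formula for the one-step predictor: `Ŵ_1 = 0`, `Ŵ_t = Θ_{t-1,1} R_{t-1}`. -/
def predictor {T : ℕ} (ξ : Param n) (y : Data n T) (t : ℕ) : Fin n → ℝ :=
  if t = 1 then 0 else ξ.coef T (t - 1) *ᵥ innov ξ y (t - 1)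

/-- `Z` is the one-step predictor of `W_t`: the orthogonal projection in mean square of (each
component of) `W_t` onto the linear span of the components of `W_1, …, W_{t-1}`. -/
def IsOneStepPredictor {Ω : Type u} [MeasurableSpace Ω] (P : Measure Ω)
    (W : ℕ → Ω → Fin n → ℝ) (t : ℕ) (Z : Ω → Fin n → ℝ) : Prop :=
  (∃ A : ℕ → Matrix (Fin n) (Fin n) ℝ,
    Z =ᵐ[P] fun ω => ∑ s ∈ Finset.Ico 1 t, A s *ᵥ W s ω) ∧
  ∀ s ∈ Finset.Ico 1 t, ∀ i j, ∫ ω, (W t ω - Z ω) i * W s ω j ∂P = 0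

/-- Values of the statistic: a family, indexed by `t` and `0 ≤ j ≤ t - 1`, of `n × n` arrays. -/
abbrev Stat (n T : ℕ) : Type := (t : Fin T) → Fin ((t : ℕ) + 1) → Fin n → Fin n → ℝ

/-- The statistic `ξ̂(Y) = ((Y_t Y_{t-j}ᵀ)_{j = 0, …, t-1})_{t = 1, …, T}`. -/
def stat {T : ℕ} (y : Data n T) : Stat n T :=
  fun t j i k => y t i * y ⟨(t : ℕ) - (j : ℕ), by omega⟩ k

/-- The statistical model: the laws of the data set `(Y_1, …, Y_T)` of all VARMA(1,1) processes
with admissible parameters. -/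
def model (n T : ℕ) : Set (Measure (Data n T)) :=
  {μ | ∃ ξ : Param n, ξ.Admissible ∧
    ∃ (Ω : Type u) (_ : MeasurableSpace Ω) (P : Measure Ω) (_ : IsProbabilityMeasure P)
      (Y ε : ℤ → Ω → Fin n → ℝ), IsProcess P ξ Y ε ∧ μ = P.map (sample T Y)}

/-- The statistic `S` is sufficient for the model `M`: the conditional distribution of the data
given `S` can be chosen independently of the law in the model. -/
def IsSufficient {X Z : Type*} [MeasurableSpace X] [MeasurableSpace Z] (M : Set (Measure X))
    (S : X → Z) : Prop :=
  Measurable S ∧ ∃ κ : Kernel Z X, IsMarkovKernel κ ∧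
    ∀ μ ∈ M, μ.map (fun x => (S x, x)) = (μ.map S) ⊗ₘ κ

end VARMA

end

/-! Write `Γ(k)` for the lag-`k` autocovariance. Causality makes the noise uncorrelated with the
past of `Y`, so `Γ(1) = ΦΓ(0) + ΘΣ_ε` and `Γ(k+2) = ΦΓ(k+1)`. The covariance hypothesis says that
the spectral density is invariant under `z ↦ z⁻¹`; comparing Fourier coefficients, every `Γ(k)` is a
symmetric matrix (`Param.SymmetricCovariance.pow_mul_symm`). Transposing the recursions puts `Φᵀ` on
the right: `Γ(1) = Γ(0)Φᵀ + Σ_εΘᵀ` and `Γ(k+2) = Γ(k+1)Φᵀ`. Hence `W_s = Y_s - ΦY_{s+1}` is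
correlated with `Y_{s+1}` and with no later `Y_u` (`cross_forward`), so the covariance of `W_1, …,
W_T` is block tridiagonal. Gram–Schmidt then needs one coefficient per step, `R_{t+1} = W_{t+1} -
Θ_{t,1}R_t`, and the sums with `C_{j,t}` are this recursion unrolled (`innov_succ`, `cross_innov`).

Each `Σ_t` is positive definite because its excess over `ΘΣ_εΘᵀ` stays positive definite for `t <
T`, by the Woodbury identity, and because `Γ_Y(0) - Σ_ε`, the second moment of `Y_t - ε_t`, can only
help at the last step (`Param.predCov_posDef`).

The sample is a mean-square limit of linear images of the noise, hence Gaussian. Its innovations are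
jointly Gaussian and uncorrelated, hence independent with laws `N(0, Σ_t)` (`map_innovMap`). The map
from data to innovations is a product of unipotent maps and has determinant one (`det_innovMap`), so
the likelihood is the product of the innovation densities with no Jacobian factor (`map_sample`).
Its exponent is quadratic in the data, and the statistic lists all products of two observations. The
likelihood is therefore a positive function of the statistic, and sufficiency is the factorization
criterion (`isSufficient_of_factorization`). -/

namespace VARMA

open Filter Topology
open scoped ENNReal

/-! ### Densities under maps and kernels; the factorization criterion -/

section Density

lemma map_withDensity_comp {α β : Type*} [MeasurableSpace α] [MeasurableSpace β] (μ : Measure α)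
    {S : α → β} (hS : Measurable S) {f : β → ℝ≥0∞} (hf : Measurable f) :
    (μ.withDensity fun a => f (S a)).map S = (μ.map S).withDensity f := by
  ext s hs
  rw [Measure.map_apply hS hs, withDensity_apply _ (hS hs), withDensity_apply _ hs,
    setLIntegral_map hs hf hS]

/-- Reweighting by a function of the first coordinate changes the marginal and leaves the kernel
alone; this is why laws whose relative density factors through a statistic share their conditional
distributions. -/
lemma withDensity_compProd_left {α β : Type*} [MeasurableSpace α] [MeasurableSpace β]
    (μ : Measure α) [SFinite μ] (κ : Kernel α β) [IsSFiniteKernel κ] {f : α → ℝ≥0∞}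
    (hf : Measurable f) :
    (μ.withDensity f) ⊗ₘ κ = (μ ⊗ₘ κ).withDensity fun p => f p.1 := by
  ext s hs
  rw [Measure.compProd_apply hs, withDensity_apply _ hs, ← lintegral_indicator hs,
    Measure.lintegral_compProd ((show Measurable fun p : α × β => f p.1 from hf.comp measurable_fst).indicator hs),
    lintegral_withDensity_eq_lintegral_mul _ hf (Kernel.measurable_kernel_prodMk_left hs)]
  refine lintegral_congr fun a => ?_
  have : (fun b => s.indicator (fun p : α × β => f p.1) (a, b)) =
      (Prod.mk a ⁻¹' s).indicator fun _ => f a := by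
    ext b; rfl
  rw [Pi.mul_apply, this, lintegral_indicator_const (measurable_prodMk_left hs)]

/-- The factorization criterion for sufficiency, for mutually absolutely continuous models. -/
theorem isSufficient_of_factorization {X Z : Type*} [MeasurableSpace X] [MeasurableSpace Z]
    [StandardBorelSpace X] [Nonempty X] (vol : Measure X) {S : X → Z} (hS : Measurable S)
    {M : Set (Measure X)}
    (hM : ∀ μ ∈ M, IsFiniteMeasure μ ∧ ∃ g : Z → ℝ≥0∞, Measurable g ∧
      (∀ z, g z ≠ 0 ∧ g z ≠ ∞) ∧ μ = vol.withDensity fun x => g (S x)) :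
    IsSufficient M S := by
  refine ⟨hS, ?_⟩
  rcases M.eq_empty_or_nonempty with rfl | ⟨ν, hν⟩
  -- For an empty model any Markov kernel serves.
  · exact ⟨Kernel.const Z (Measure.dirac (Classical.arbitrary X)), inferInstance, by simp⟩
  obtain ⟨hνf, g₀, hg₀, hg₀pos, hνeq⟩ := hM ν hν
  -- The conditional law under one reference member `ν` works for all: any other member has density
  -- `g / g₀` with respect to `ν`, a function of `S` alone.
  refine ⟨condDistrib id S ν, inferInstance, fun μ hμ => ?_⟩
  obtain ⟨hμf, g, hg, hgpos, hμeq⟩ := hM μ hμ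
  have hF : Measurable fun z => g z / g₀ z := hg.div hg₀
  have hμν : μ = ν.withDensity fun x => g (S x) / g₀ (S x) := by
    have hmul := withDensity_mul vol (hg₀.comp hS) (hF.comp hS)
    rw [hμeq, hνeq]
    refine Eq.trans ?_ hmul
    congr 1
    ext x
    exact (ENNReal.mul_div_cancel (hg₀pos _).1 (hg₀pos _).2).symm
  have hpair : Measurable fun x => (S x, x) := hS.prodMk measurable_id
  have hcond : (ν.map S) ⊗ₘ condDistrib id S ν = ν.map fun x => (S x, x) :=
    compProd_map_condDistrib aemeasurable_id
  rw [hμν, map_withDensity_comp ν hpair (f := fun p : Z × X => g p.1 / g₀ p.1)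
    (hF.comp measurable_fst), map_withDensity_comp ν hS (f := fun z => g z / g₀ z) hF,
    withDensity_compProd_left _ _ hF, hcond]

lemma pi_withDensity_ofReal {ι : Type*} [Fintype ι] {E : ι → Type*} [∀ i, MeasurableSpace (E i)]
    (μ : ∀ i, Measure (E i)) [∀ i, SigmaFinite (μ i)] {f : ∀ i, E i → ℝ}
    (hf : ∀ i, Integrable (f i) (μ i)) (h0 : ∀ i x, 0 ≤ f i x) :
    Measure.pi (fun i => (μ i).withDensity fun x => ENNReal.ofReal (f i x)) =
      (Measure.pi μ).withDensity fun x => ENNReal.ofReal (∏ i, f i (x i)) := by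
  have hfin : ∀ i, IsFiniteMeasure ((μ i).withDensity fun x => ENNReal.ofReal (f i x)) :=
    fun i => isFiniteMeasure_withDensity_ofReal (hf i).2
  refine Measure.pi_eq fun s hs => ?_
  rw [withDensity_apply _ (MeasurableSet.univ_pi hs), Measure.restrict_pi_pi,
    ← ofReal_integral_eq_lintegral_ofReal, integral_fintype_prod_eq_prod,
    ENNReal.ofReal_prod_of_nonneg fun i _ => integral_nonneg (h0 i)]
  · refine Finset.prod_congr rfl fun i _ => ?_
    rw [withDensity_apply _ (hs i), ofReal_integral_eq_lintegral_ofReal (hf i).restrict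
      (ae_of_all _ (h0 i))]
  · exact Integrable.fintype_prod_dep fun i => (hf i).restrict
  · exact ae_of_all _ fun x => Finset.prod_nonneg fun i _ => h0 i _

/-- As `f = (f ∘ B) ∘ A`, the density factors through `A`, and what remains is the scaling of Haar
measure by `A`. The left inverse also forces `det A ≠ 0`. -/
lemma map_withDensity_linearMap {E : Type*} [NormedAddCommGroup E] [NormedSpace ℝ E]
    [MeasurableSpace E] [BorelSpace E] [FiniteDimensional ℝ E] (μ : Measure E)
    [μ.IsAddHaarMeasure] (A : E →ₗ[ℝ] E) (B : E →ₗ[ℝ] E) (hAB : ∀ x, B (A x) = x)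
    {f : E → ℝ≥0∞} (hf : Measurable f) :
    (μ.withDensity f).map A =
      ENNReal.ofReal |(LinearMap.det A)⁻¹| • μ.withDensity fun x => f (B x) := by
  have hBA : B ∘ₗ A = LinearMap.id := LinearMap.ext hAB
  have hdet : LinearMap.det A ≠ 0 := by
    intro h
    have := congrArg LinearMap.det hBA
    rw [LinearMap.det_comp, h, mul_zero, LinearMap.det_id] at this
    exact zero_ne_one this
  have hA : Measurable A := (LinearMap.continuous_of_finiteDimensional A).measurable
  have hB : Measurable B := (LinearMap.continuous_of_finiteDimensional B).measurable
  have h := map_withDensity_comp μ hA (hf.comp hB)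
  simp only [Function.comp_apply, hAB] at h
  rw [h, Measure.map_linearMap_addHaar_eq_smul_addHaar μ hdet, withDensity_smul_measure]
  rfl

end Density

/-! ### The density of a nondegenerate Gaussian vector -/

section Gaussian

/-- The density of the centered Gaussian law on `Fin n → ℝ` with covariance matrix `S`. -/
noncomputable def gaussDensity {n : ℕ} (S : Matrix (Fin n) (Fin n) ℝ) (x : Fin n → ℝ) : ℝ :=
  (2 * Real.pi) ^ (-((n : ℝ) / 2)) * S.det ^ (-(1 / 2) : ℝ) * Real.exp (-(x ⬝ᵥ (S⁻¹ *ᵥ x) / 2))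

lemma gaussDensity_pos {n : ℕ} {S : Matrix (Fin n) (Fin n) ℝ} (hS : S.PosDef) (x : Fin n → ℝ) :
    0 < gaussDensity S x := by
  have := hS.det_pos
  unfold gaussDensity
  positivity

lemma continuous_gaussDensity {n : ℕ} (S : Matrix (Fin n) (Fin n) ℝ) :
    Continuous (gaussDensity S) := by
  unfold gaussDensity
  have : Continuous fun x : Fin n → ℝ => x ⬝ᵥ (S⁻¹ *ᵥ x) :=
    continuous_id.dotProduct (continuous_const.matrix_mulVec continuous_id)
  fun_prop

lemma pi_gaussianReal_eq_withDensity (n : ℕ) :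
    Measure.pi (fun _ : Fin n => gaussianReal 0 1) =
      volume.withDensity fun x : Fin n → ℝ =>
        ENNReal.ofReal ((2 * Real.pi) ^ (-((n : ℝ) / 2)) * Real.exp (-(x ⬝ᵥ x / 2))) := by
  have h1 : gaussianReal 0 1 = volume.withDensity fun x =>
      ENNReal.ofReal (gaussianPDFReal 0 1 x) := by
    rw [gaussianReal_of_var_ne_zero _ one_ne_zero]; rfl
  rw [h1, pi_withDensity_ofReal _ (fun _ => integrable_gaussianPDFReal 0 1)
    (fun _ => gaussianPDFReal_nonneg 0 1), volume_pi]
  congr 1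
  ext x
  congr 1
  simp only [gaussianPDFReal, Finset.prod_mul_distrib, Finset.prod_const, Finset.card_univ,
    Fintype.card_fin, ← Real.exp_sum, NNReal.coe_one, mul_one, sub_zero]
  congr 1
  · rw [Real.sqrt_eq_rpow, ← Real.rpow_neg (by positivity), ← Real.rpow_natCast,
      ← Real.rpow_mul (by positivity)]
    congr 1; ring
  · congr 1
    rw [← Finset.sum_div, Finset.sum_neg_distrib, neg_div]
    simp [dotProduct, sq]

open scoped MatrixOrder Matrix.Norms.L2Operator in
-- The law is the image of the standard Gaussian under the symmetric square root `Q` of `S`. The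
-- Jacobian is `|det Q|⁻¹ = (det S)^(-1/2)`, and `|Q⁻¹x|² = xᵀS⁻¹x`.
lemma map_multivariateGaussian_eq_withDensity {n : ℕ} {S : Matrix (Fin n) (Fin n) ℝ}
    (hS : S.PosDef) :
    (multivariateGaussian 0 S).map WithLp.ofLp =
      volume.withDensity fun x => ENNReal.ofReal (gaussDensity S x) := by
  obtain ⟨Q, hQT, hQ⟩ : ∃ Q : Matrix (Fin n) (Fin n) ℝ, Qᵀ = Q ∧ Q * Q = S ∧
      Q = CFC.sqrt S := by
    refine ⟨CFC.sqrt S, ?_, ?_, rfl⟩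
    · have : (CFC.sqrt S).IsHermitian := by
        have := CFC.sqrt_nonneg S
        exact (Matrix.nonneg_iff_posSemidef.mp this).isHermitian
      simpa using this.eq
    · exact CFC.sqrt_mul_sqrt_self S (Matrix.nonneg_iff_posSemidef.mpr hS.posSemidef)
  obtain ⟨hQQ, hQS⟩ := hQ
  have hdet : Q.det * Q.det = S.det := by rw [← det_mul, hQQ]
  have hSpos := hS.det_pos
  have hQ0 : Q.det ≠ 0 := fun h => by rw [h] at hdet; simp at hdet; linarith
  have hQu : IsUnit Q.det := isUnit_iff_ne_zero.mpr hQ0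
  have hlaw : (multivariateGaussian 0 S).map WithLp.ofLp =
      (Measure.pi (fun _ : Fin n => gaussianReal 0 1)).map (Matrix.toLin' Q) := by
    rw [multivariateGaussian, ← map_pi_eq_stdGaussian, Measure.map_map (by fun_prop) (by fun_prop),
      Measure.map_map (by fun_prop) (by fun_prop), ← hQS]
    congr 1
    ext x
    simp
  rw [hlaw, pi_gaussianReal_eq_withDensity,
    map_withDensity_linearMap volume (Matrix.toLin' Q) (Matrix.toLin' Q⁻¹)
      (fun x => by simp [Matrix.mulVec_mulVec, Matrix.nonsing_inv_mul _ hQu])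
      (by
        refine Measurable.ennreal_ofReal (Continuous.measurable ?_)
        have : Continuous fun x : Fin n → ℝ => x ⬝ᵥ x := continuous_id.dotProduct continuous_id
        fun_prop),
    ← withDensity_smul _ (by
        refine Measurable.ennreal_ofReal (Continuous.measurable ?_)
        have : Continuous fun x : Fin n → ℝ => (Q⁻¹ *ᵥ x) ⬝ᵥ (Q⁻¹ *ᵥ x) :=
          (continuous_const.matrix_mulVec continuous_id).dotProduct
            (continuous_const.matrix_mulVec continuous_id)
        simp only [Matrix.toLin'_apply]
        fun_prop)]
  congr 1
  ext x
  rw [Pi.smul_apply, smul_eq_mul, ← ENNReal.ofReal_mul (abs_nonneg _), LinearMap.det_toLin']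
  congr 1
  have habs : |Q.det⁻¹| = S.det ^ (-(1 / 2) : ℝ) := by
    rw [Real.rpow_neg hSpos.le, ← Real.sqrt_eq_rpow, ← hdet, Real.sqrt_mul_self_eq_abs, abs_inv]
  have hquad : (Matrix.toLin' Q⁻¹ x) ⬝ᵥ (Matrix.toLin' Q⁻¹ x) = x ⬝ᵥ (S⁻¹ *ᵥ x) := by
    rw [Matrix.toLin'_apply, ← hQQ, Matrix.mul_inv_rev, ← Matrix.mulVec_mulVec,
      Matrix.dotProduct_mulVec x, ← Matrix.mulVec_transpose, Matrix.transpose_nonsing_inv, hQT]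
  rw [habs, hquad, gaussDensity]
  ring

/-- No integral is computed: the total mass is that of a probability law by the preceding lemma. -/
lemma integrable_gaussDensity {n : ℕ} {S : Matrix (Fin n) (Fin n) ℝ} (hS : S.PosDef) :
    Integrable (gaussDensity S) := by
  refine ⟨(continuous_gaussDensity S).aestronglyMeasurable, ?_⟩
  rw [hasFiniteIntegral_iff_ofReal (ae_of_all _ fun x => (gaussDensity_pos hS x).le),
    ← setLIntegral_univ, ← withDensity_apply _ MeasurableSet.univ,
    ← map_multivariateGaussian_eq_withDensity hS]
  exact measure_lt_top _ _

end Gaussian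

end VARMA

namespace VARMA

open Filter Topology
open scoped ENNReal

/-! ### Mean-square limits of Gaussian laws -/

section GaussianLimit

variable {Ω : Type*} [MeasurableSpace Ω] {P : Measure Ω}

lemma tendsto_integral_mul_of_eLpNorm {X Z : ℕ → Ω → ℝ} {x z : Ω → ℝ}
    (hX : ∀ k, MemLp (X k) 2 P) (hx : MemLp x 2 P) (hZ : ∀ k, MemLp (Z k) 2 P) (hz : MemLp z 2 P)
    (hXx : Tendsto (fun k => eLpNorm (X k - x) 2 P) atTop (𝓝 0))
    (hZz : Tendsto (fun k => eLpNorm (Z k - z) 2 P) atTop (𝓝 0)) :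
    Tendsto (fun k => ∫ ω, X k ω * Z k ω ∂P) atTop (𝓝 (∫ ω, x ω * z ω ∂P)) := by
  have key : ∀ {f g : Ω → ℝ} (hf : MemLp f 2 P) (hg : MemLp g 2 P),
      ∫ ω, f ω * g ω ∂P = inner ℝ (hf.toLp f) (hg.toLp g) := by
    intro f g hf hg
    rw [L2.inner_def]
    refine integral_congr_ae ?_
    filter_upwards [hf.coeFn_toLp, hg.coeFn_toLp] with ω h1 h2
    rw [h1, h2]
    simp [mul_comm]
  rw [key hx hz]
  simp_rw [fun k => key (hX k) (hZ k)]
  exact ((Lp.tendsto_Lp_iff_tendsto_eLpNorm'' X hX x hx).2 hXx).inner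
    ((Lp.tendsto_Lp_iff_tendsto_eLpNorm'' Z hZ z hz).2 hZz)

variable [IsProbabilityMeasure P]

/-- Mean-square convergence carries means and variances to the limit, and characteristic functions
too, since `|e^{ia} - e^{ib}| ≤ |a - b|`. The limiting characteristic function thus has Gaussian
form. -/
lemma hasGaussianLaw_of_tendsto_eLpNorm {X : ℕ → Ω → ℝ} {x : Ω → ℝ}
    (hX : ∀ k, HasGaussianLaw (X k) P) (hx : MemLp x 2 P)
    (hXx : Tendsto (fun k => eLpNorm (X k - x) 2 P) atTop (𝓝 0)) :
    HasGaussianLaw x P := by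
  have hX2 : ∀ k, MemLp (X k) 2 P := fun k => (hX k).memLp_two
  have hone : MemLp (fun _ : Ω => (1 : ℝ)) 2 P := memLp_const 1
  have hmean : Tendsto (fun k => ∫ ω, X k ω ∂P) atTop (𝓝 (∫ ω, x ω ∂P)) := by
    simpa using tendsto_integral_mul_of_eLpNorm hX2 hx (fun _ => hone) hone hXx (by simp)
  have hvar : Tendsto (fun k => Var[X k; P]) atTop (𝓝 (Var[x; P])) := by
    have h2 := tendsto_integral_mul_of_eLpNorm hX2 hx hX2 hx hXx hXx
    rw [variance_eq_sub hx]
    simp_rw [fun k => variance_eq_sub (hX2 k)]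
    simpa [sq] using h2.sub (hmean.mul hmean)
  have hchar : ∀ t : ℝ, Tendsto (fun k => charFun (P.map (X k)) t) atTop
      (𝓝 (charFun (P.map x) t)) := by
    intro t
    have hcf : ∀ {f : Ω → ℝ}, AEMeasurable f P →
        charFun (P.map f) t = ∫ ω, Complex.exp (Complex.I * (t * f ω : ℝ)) ∂P := by
      intro f hf
      rw [charFun_apply_real, integral_map hf (by fun_prop)]
      refine integral_congr_ae (ae_of_all _ fun ω => ?_)
      simp only [Complex.ofReal_mul]
      ring_nf
    rw [hcf hx.aestronglyMeasurable.aemeasurable]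
    simp_rw [fun k => hcf (hX2 k).aestronglyMeasurable.aemeasurable]
    have hint : ∀ {f : Ω → ℝ}, AEMeasurable f P →
        Integrable (fun ω => Complex.exp (Complex.I * (t * f ω : ℝ))) P := by
      intro f hf
      refine Integrable.of_bound (C := 1) ?_ (ae_of_all _ fun ω => ?_)
      · have : Measurable fun r : ℝ => Complex.exp (Complex.I * (t * r : ℝ)) := by fun_prop
        exact (this.comp_aemeasurable hf).aestronglyMeasurable
      · rw [mul_comm, Complex.norm_exp_ofReal_mul_I]
    rw [tendsto_iff_norm_sub_tendsto_zero]
    have h1 : Tendsto (fun k => |t| * (eLpNorm (X k - x) 2 P).toReal) atTop (𝓝 0) := by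
      have := (ENNReal.tendsto_toReal ENNReal.zero_ne_top).comp hXx
      simpa using this.const_mul |t|
    refine squeeze_zero (fun _ => norm_nonneg _) (fun k => ?_) h1
    have hd : MemLp (X k - x) 2 P := (hX2 k).sub hx
    have hd1 : Integrable (X k - x) P := hd.integrable (by norm_num)
    rw [← integral_sub (hint (hX2 k).aestronglyMeasurable.aemeasurable)
      (hint hx.aestronglyMeasurable.aemeasurable)]
    calc ‖∫ ω, (Complex.exp (Complex.I * (t * X k ω : ℝ)) -
          Complex.exp (Complex.I * (t * x ω : ℝ))) ∂P‖
        ≤ ∫ ω, |t| * ‖(X k - x) ω‖ ∂P := by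
          refine norm_integral_le_of_norm_le (hd1.norm.const_mul _) (ae_of_all _ fun ω => ?_)
          have : Complex.exp (Complex.I * (t * X k ω : ℝ)) - Complex.exp (Complex.I * (t * x ω : ℝ))
              = Complex.exp ((t * x ω : ℝ) * Complex.I) *
                (Complex.exp (Complex.I * (t * (X k ω - x ω) : ℝ)) - 1) := by
            rw [mul_sub, ← Complex.exp_add, mul_one]
            push_cast
            ring_nf
          rw [this, norm_mul, Complex.norm_exp_ofReal_mul_I, one_mul]
          refine (Real.norm_exp_I_mul_ofReal_sub_one_le).trans ?_
          simp
      _ = |t| * (eLpNorm (X k - x) 1 P).toReal := by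
          rw [integral_const_mul, integral_norm_eq_lintegral_enorm hd1.1, eLpNorm_one_eq_lintegral_enorm]
      _ ≤ |t| * (eLpNorm (X k - x) 2 P).toReal := by
          gcongr
          · exact hd.2.ne
          · exact eLpNorm_le_eLpNorm_of_exponent_le (by norm_num) hd.1
  rw [hasGaussianLaw_iff_charFun_map_eq hx.aestronglyMeasurable.aemeasurable]
  intro t
  refine tendsto_nhds_unique (hchar t) ?_
  simp_rw [fun k => (hX k).charFun_map_eq t]
  have hin : ∀ f : Ω → ℝ, (fun ω => inner ℝ t (f ω)) = fun ω => t * f ω := by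
    intro f; ext ω; simp [mul_comm]
  simp_rw [hin, integral_const_mul, variance_const_mul]
  refine (Complex.continuous_exp.tendsto _).comp ?_
  refine Tendsto.sub ?_ ?_
  · exact (((Complex.continuous_ofReal.tendsto _).comp (hmean.const_mul t))).mul_const _
  · exact ((Complex.continuous_ofReal.tendsto _).comp (hvar.const_mul (t ^ 2))).div_const _

lemma eq_sum_smul_single {n T : ℕ} (y : Data n T) :
    y = ∑ t, ∑ i, y t i • (Pi.single t (Pi.single i 1) : Data n T) := by
  ext t i
  simp only [Finset.sum_apply, Pi.smul_apply, smul_eq_mul]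
  rw [Finset.sum_eq_single t (fun s _ hs => by simp [Pi.single_eq_of_ne hs.symm]) (by simp)]
  simp [Pi.single_apply]

/-- A componentwise mean-square limit of Gaussian families is Gaussian. -/
lemma hasGaussianLaw_pi_of_tendsto_eLpNorm {n T : ℕ} {X : ℕ → Ω → Data n T} {x : Ω → Data n T}
    (hX : ∀ k, HasGaussianLaw (X k) P) (hx : Measurable x)
    (hx2 : ∀ t i, MemLp (fun ω => x ω t i) 2 P)
    (hXx : ∀ t i, Tendsto (fun k => eLpNorm (fun ω => X k ω t i - x ω t i) 2 P) atTop (𝓝 0)) :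
    HasGaussianLaw x P := by
  -- Gaussianity is tested on linear functionals; each is a finite combination of coordinates, so
  -- the scalar limit applies to it.
  refine ⟨isGaussian_of_isGaussian_map fun L => ?_⟩
  have hexp : ∀ y : Data n T, L y = ∑ t, ∑ i, L (Pi.single t (Pi.single i 1)) * y t i := by
    intro y
    conv_lhs => rw [eq_sum_smul_single y]
    simp only [map_sum, map_smul, smul_eq_mul]
    exact Finset.sum_congr rfl fun t _ => Finset.sum_congr rfl fun i _ => mul_comm _ _
  have hXm : ∀ k t i, MemLp (fun ω => X k ω t i) 2 P := fun k t i =>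
    (((hX k).map (ContinuousLinearMap.proj t)).map (ContinuousLinearMap.proj i)).memLp_two
  have hmain : HasGaussianLaw (fun ω => L (x ω)) P := by
    refine hasGaussianLaw_of_tendsto_eLpNorm (fun k => (hX k).map_fun L) ?_ ?_
    · rw [show (fun ω => L (x ω)) = fun ω => _ from funext fun ω => hexp (x ω)]
      exact memLp_finsetSum _ fun t _ => memLp_finsetSum _ fun i _ => (hx2 t i).const_mul _
    · have hbound : ∀ k, eLpNorm ((fun ω => L (X k ω)) - fun ω => L (x ω)) 2 P ≤
          ∑ t, ∑ i, ‖L (Pi.single t (Pi.single i 1))‖ₑ *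
            eLpNorm (fun ω => X k ω t i - x ω t i) 2 P := by
        intro k
        have : ((fun ω => L (X k ω)) - fun ω => L (x ω)) =
            ∑ t, ∑ i, L (Pi.single t (Pi.single i 1)) • fun ω => (X k ω t i - x ω t i) := by
          ext ω
          rw [Pi.sub_apply, hexp (X k ω), hexp (x ω)]
          simp [Finset.sum_apply, mul_sub]
        rw [this]
        refine (eLpNorm_sum_le (fun t _ => ?_) (by norm_num)).trans (Finset.sum_le_sum fun t _ =>
          (eLpNorm_sum_le (fun i _ => ?_) (by norm_num)).trans (Finset.sum_le_sum fun i _ => ?_))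
        · exact Finset.aestronglyMeasurable_sum _ fun i _ =>
            ((hXm k t i).sub (hx2 t i)).1.const_smul _
        · exact ((hXm k t i).sub (hx2 t i)).1.const_smul _
        · rw [eLpNorm_const_smul]
      refine tendsto_of_tendsto_of_tendsto_of_le_of_le tendsto_const_nhds ?_
        (fun _ => zero_le) hbound
      have : (0 : ℝ≥0∞) = ∑ t : Fin T, ∑ i : Fin n, ‖L (Pi.single t (Pi.single i 1))‖ₑ * 0 := by
        simp
      rw [this]
      exact tendsto_finsetSum _ fun t _ => tendsto_finsetSum _ fun i _ =>
        ENNReal.Tendsto.const_mul (hXx t i) (Or.inr enorm_ne_top)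
  rw [Measure.map_map (by fun_prop) hx]
  exact hmain.isGaussian_map

end GaussianLimit

end VARMA

namespace VARMA

open Filter Topology
open scoped ENNReal NNReal

/-! ### Decay of the powers of `Φ` -/

section Powers

variable {n : ℕ}

open scoped Matrix.Norms.Operator in
-- Gelfand's formula: `‖A^k‖^(1/k)` tends to the spectral radius. The row-sum norm dominates every
-- entry.
lemma exists_norm_pow_le_of_spectralRadius_lt_one (A : Matrix (Fin n) (Fin n) ℂ)
    (hA : spectralRadius ℂ A < 1) :
    ∃ r : ℝ≥0, r < 1 ∧ ∀ᶠ k : ℕ in atTop, ∀ i j, ‖(A ^ k) i j‖ ≤ (r : ℝ) ^ k := by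
  obtain ⟨r, hr, hr1⟩ := ENNReal.lt_iff_exists_nnreal_btwn.1 hA
  refine ⟨r, by exact_mod_cast hr1, ?_⟩
  have h := (spectrum.pow_nnnorm_pow_one_div_tendsto_nhds_spectralRadius A).eventually_lt_const hr
  filter_upwards [h, eventually_gt_atTop 0] with k hk hk0 i j
  have hk' : ‖A ^ k‖₊ ≤ r ^ k := by
    have hkpos : (0 : ℝ) < k := by exact_mod_cast hk0
    have h2 := (ENNReal.rpow_le_rpow hk.le hkpos.le)
    rw [← ENNReal.rpow_mul, one_div, inv_mul_cancel₀ hkpos.ne', ENNReal.rpow_one,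
      ENNReal.rpow_natCast] at h2
    exact_mod_cast h2
  have hentry : ‖(A ^ k) i j‖₊ ≤ ‖A ^ k‖₊ := by
    rw [Matrix.linfty_opNNNorm_def]
    exact (Finset.single_le_sum (f := fun j => ‖(A ^ k) i j‖₊) (fun _ _ => zero_le)
      (Finset.mem_univ j)).trans (Finset.le_sup (f := fun i => ∑ j, ‖(A ^ k) i j‖₊)
        (Finset.mem_univ i))
  exact_mod_cast hentry.trans hk'

open scoped Matrix.Norms.Operator in
-- A spectral value `z` with `|z| ≥ 1` would make `1 - z⁻¹A` singular although `|z⁻¹| ≤ 1`; so the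
-- spectral radius is below one.
lemma summable_norm_pow_of_det_ne_zero (A : Matrix (Fin n) (Fin n) ℂ)
    (hA : ∀ z : ℂ, ‖z‖ ≤ 1 → (1 - z • A).det ≠ 0) (i j : Fin n) :
    Summable fun k => ‖(A ^ k) i j‖ := by
  have : Nonempty (Fin n) := ⟨i⟩
  have hrad : spectralRadius ℂ A < (1 : ℝ≥0) := by
    refine spectrum.spectralRadius_lt_of_forall_lt A fun z hz => ?_
    by_contra! hz1
    have hz1' : (1 : ℝ) ≤ ‖z‖ := by exact_mod_cast hz1
    have hz0 : z ≠ 0 := fun h => by rw [h, norm_zero] at hz1'; linarith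
    have hdet := hA z⁻¹ (by rw [norm_inv]; exact inv_le_one_of_one_le₀ hz1')
    refine spectrum.mem_iff.1 hz ?_
    rw [Matrix.isUnit_iff_isUnit_det, isUnit_iff_ne_zero]
    have : algebraMap ℂ (Matrix (Fin n) (Fin n) ℂ) z - A = z • (1 - z⁻¹ • A) := by
      rw [smul_sub, smul_smul, mul_inv_cancel₀ hz0, one_smul, Algebra.algebraMap_eq_smul_one]
    rw [this, det_smul]
    exact mul_ne_zero (pow_ne_zero _ hz0) hdet
  obtain ⟨r, hr, h⟩ := exists_norm_pow_le_of_spectralRadius_lt_one A (by exact_mod_cast hrad)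
  refine Summable.of_norm_bounded_eventually_nat
    (summable_geometric_of_lt_one r.coe_nonneg (by exact_mod_cast hr)) ?_
  filter_upwards [h] with k hk
  simpa using hk i j

lemma map_ofReal_pow (A : Matrix (Fin n) (Fin n) ℝ) (k : ℕ) :
    (A.map Complex.ofReal) ^ k = (A ^ k).map Complex.ofReal :=
  (Matrix.map_pow (f := Complex.ofRealHom) A k).symm

lemma Param.CausalInvertible.summable_abs_pow {ξ : Param n} (h : ξ.CausalInvertible)
    (i j : Fin n) : Summable fun k => |(ξ.Phi ^ k) i j| := by
  have := summable_norm_pow_of_det_ne_zero (ξ.Phi.map Complex.ofReal)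
    (fun z hz => (h z hz).1) i j
  simpa [map_ofReal_pow] using this

lemma Param.CausalInvertible.tendsto_pow {ξ : Param n} (h : ξ.CausalInvertible)
    (i j : Fin n) : Tendsto (fun k => (ξ.Phi ^ k) i j) atTop (𝓝 0) :=
  (h.summable_abs_pow i j).of_abs.tendsto_atTop_zero

lemma tendsto_pow_matrix {A : Matrix (Fin n) (Fin n) ℝ}
    (h : ∀ i j, Tendsto (fun k => (A ^ k) i j) atTop (𝓝 0)) :
    Tendsto (fun k => A ^ k) atTop (𝓝 0) :=
  tendsto_pi_nhds.2 fun i => tendsto_pi_nhds.2 fun j => h i j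

/-- The solution of a discrete Lyapunov equation as a series. -/
lemma hasSum_pow_mul_mul_pow_transpose {A M G : Matrix (Fin n) (Fin n) ℝ}
    (hA : ∀ i j, Summable fun k => |(A ^ k) i j|) (hG : G = A * G * Aᵀ + M) :
    HasSum (fun k => A ^ k * M * (A ^ k)ᵀ) G := by
  have hsum : Summable fun k => A ^ k * M * (A ^ k)ᵀ := by
    refine Pi.summable.2 fun i => Pi.summable.2 fun j => ?_
    simp only [Matrix.mul_apply, Finset.sum_mul, Matrix.transpose_apply]
    refine summable_sum fun b _ => summable_sum fun a _ => ?_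
    have h1 := ((hA i a).mul_of_nonneg (hA j b) (fun _ => abs_nonneg _)
      (fun _ => abs_nonneg _))
    -- One factor is summable and the other is eventually at most one.
    have h2 : Summable fun k => |(A ^ k) i a| * |(A ^ k) j b| := by
      have ht := (hA j b).tendsto_atTop_zero.eventually_le_const (zero_lt_one)
      refine Summable.of_norm_bounded_eventually_nat (hA i a) ?_
      filter_upwards [ht] with k hk
      rw [norm_mul, Real.norm_eq_abs, Real.norm_eq_abs, abs_abs, abs_abs]
      exact mul_le_of_le_one_right (abs_nonneg _) hk
    refine Summable.of_norm_bounded (h2.mul_left |M a b|) fun k => le_of_eq ?_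
    rw [Real.norm_eq_abs, abs_mul, abs_mul]
    ring
  -- The equation for `G` makes the sum telescope, each term being `A^k G (A^k)ᵀ - A^(k+1) G
  -- (A^(k+1))ᵀ`.
  have hpart : ∀ N, ∑ k ∈ Finset.range N, A ^ k * M * (A ^ k)ᵀ =
      G - A ^ N * G * (A ^ N)ᵀ := by
    intro N
    induction N with
    | zero => simp
    | succ N ih =>
      rw [Finset.sum_range_succ, ih]
      have : A ^ (N + 1) * G * (A ^ (N + 1))ᵀ = A ^ N * (A * G * Aᵀ) * (A ^ N)ᵀ := by
        rw [pow_succ, Matrix.transpose_mul]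
        simp only [Matrix.mul_assoc]
      rw [this, show A * G * Aᵀ = G - M from eq_sub_of_add_eq hG.symm]
      noncomm_ring
  have hlim : Tendsto (fun N => ∑ k ∈ Finset.range N, A ^ k * M * (A ^ k)ᵀ) atTop (𝓝 G) := by
    simp_rw [hpart]
    have h0 := tendsto_pow_matrix fun i j => (hA i j).of_abs.tendsto_atTop_zero
    have h0T : Tendsto (fun k => (A ^ k)ᵀ) atTop (𝓝 0) := by
      have := (continuous_id.matrix_transpose.tendsto (0 : Matrix (Fin n) (Fin n) ℝ)).comp h0
      rwa [Function.comp_def, id, Matrix.transpose_zero] at this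
    have := (h0.mul_const G).mul h0T
    simpa using this.const_sub G
  have := hsum.hasSum
  rwa [tendsto_nhds_unique this.tendsto_sum_nat hlim] at this

end Powers

/-! ### Uniqueness of sine coefficients -/

section Fourier

/-- Uniqueness of the coefficients of an absolutely convergent sine series. -/
lemma eq_zero_of_tsum_pow_sub_inv_pow {c : ℕ → ℂ} (hc : Summable fun k => ‖c k‖)
    (h : ∀ z : ℂ, ‖z‖ = 1 → HasSum (fun k => c k * (z ^ (k + 1) - z⁻¹ ^ (k + 1))) 0) (m : ℕ) :
    c m = 0 := by
  have : Fact (0 < 2 * Real.pi) := ⟨Real.two_pi_pos⟩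
  let F : ℕ → C(AddCircle (2 * Real.pi), ℂ) := fun k =>
    c k • (fourier ((k : ℤ) + 1) - fourier (-((k : ℤ) + 1)))
  -- Characters have sup norm one, so the series converges uniformly; the constant `2` counts the
  -- two characters in each term.
  have hF : Summable F := by
    refine Summable.of_norm_bounded (hc.mul_left 2) fun k => ?_
    rw [norm_smul, mul_comm]
    gcongr
    refine (norm_sub_le _ _).trans ?_
    rw [fourier_norm, fourier_norm]
    norm_num
  have hF0 : HasSum F 0 := by
    have h1 := hF.hasSum
    have h2 : ∑' k, F k = 0 := by
      ext x
      have h3 : HasSum (fun k => F k x) ((∑' k, F k) x) :=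
        h1.map (ContinuousMap.evalCLM ℂ x) (ContinuousMap.evalCLM ℂ x).continuous
      refine h3.unique ?_
      have hx : ∀ k, F k x = c k * ((AddCircle.toCircle x : ℂ) ^ (k + 1) -
          ((AddCircle.toCircle x : ℂ))⁻¹ ^ (k + 1)) := by
        intro k
        simp only [F, ContinuousMap.smul_apply, ContinuousMap.sub_apply, smul_eq_mul,
          fourier_apply]
        congr 2
        · rw [show ((k : ℤ) + 1) • x = (k + 1) • x by
            rw [← natCast_zsmul]; push_cast; rfl, AddCircle.toCircle_nsmul]
          simp
        · rw [neg_smul, show ((k : ℤ) + 1) • x = (k + 1) • x by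
            rw [← natCast_zsmul]; push_cast; rfl, AddCircle.toCircle_neg, AddCircle.toCircle_nsmul]
          simp
      simp_rw [hx]
      exact h _ (Circle.norm_coe _)
    rwa [h2] at h1
  -- Pairing with the character of frequency `m + 1`. The frequencies `-(k + 1)` are negative and
  -- never match it, so only `c m` survives.
  let L : C(AddCircle (2 * Real.pi), ℂ) →L[ℂ] ℂ :=
    (innerSL ℂ (fourierLp 2 ((m : ℤ) + 1))).comp
      (ContinuousMap.toLp (E := ℂ) 2 AddCircle.haarAddCircle ℂ)
  have hL : ∀ k : ℤ, L (fourier k) = if (m : ℤ) + 1 = k then 1 else 0 := fun k =>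
    orthonormal_iff_ite.1 (orthonormal_fourier (T := 2 * Real.pi)) _ _
  have h4 : HasSum (fun k => L (F k)) 0 := by
    simpa [Function.comp_def] using hF0.map L L.continuous
  have h5 : ∀ k, L (F k) = if k = m then c m else 0 := by
    intro k
    have e1 : ((m : ℤ) + 1 = (k : ℤ) + 1) ↔ k = m := by omega
    have e2 : ¬ ((m : ℤ) + 1 = -((k : ℤ) + 1)) := by omega
    simp only [F, map_smul, map_sub, hL, e1, e2, if_false, sub_zero, smul_eq_mul]
    split_ifs with hk
    · rw [hk, mul_one]
    · rw [mul_zero]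
  simp_rw [h5] at h4
  exact (hasSum_ite_eq m (c m)).unique h4

end Fourier

end VARMA

namespace VARMA

open Filter Topology
-- From the symmetric spectral density to symmetric autocovariances
section Symmetry

variable {n : ℕ}

lemma hasSum_pow_inv_one_sub {A : Matrix (Fin n) (Fin n) ℂ}
    (hA : ∀ i j, Summable fun k => (A ^ k) i j) : HasSum (fun k => A ^ k) (1 - A)⁻¹ := by
  have hs : Summable fun k => A ^ k := Pi.summable.2 fun i => Pi.summable.2 fun j => hA i j
  rw [Matrix.inv_eq_left_inv hs.tsum_pow_mul_one_sub]
  exact hs.hasSum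

/-- The decomposition of the spectral density into its causal and anticausal parts. -/
lemma spectral_decomposition {F Θ S G₀ G₁ : Matrix (Fin n) (Fin n) ℂ} {z w : ℂ} (hzw : z * w = 1)
    (hz : IsUnit (1 - z • F).det) (hw : IsUnit (1 - w • F).det)
    (h0 : G₀ + F * G₀ * Fᵀ - G₁ * Fᵀ - F * G₁ᵀ = S + Θ * S * Θᵀ) (h1 : G₁ - F * G₀ = Θ * S)
    (h1' : G₁ᵀ - G₀ * Fᵀ = S * Θᵀ) :
    (1 - z • F)⁻¹ * (1 + z • Θ) * S * (1 + w • Θ)ᵀ * ((1 - w • F)ᵀ)⁻¹ =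
      G₀ + z • ((1 - z • F)⁻¹ * G₁) + w • ((1 - w • F)⁻¹ * G₁)ᵀ := by
  -- After clearing both resolvents and using `zw = 1`, the terms free of `z` and `w`, those in `z`
  -- and those in `w` are the hypotheses `h0`, `h1` and `h1'`.
  have key : (1 + z • Θ) * S * (1 + w • Θ)ᵀ =
      (1 - z • F) * G₀ * (1 - w • F)ᵀ + z • (G₁ * (1 - w • F)ᵀ) +
        w • ((1 - z • F) * G₁ᵀ) := by
    have e1 : (1 + z • Θ) * S * (1 + w • Θ)ᵀ =
        (S + Θ * S * Θᵀ) + z • (Θ * S) + w • (S * Θᵀ) := by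
      simp only [transpose_add, transpose_one, transpose_smul, Matrix.add_mul, Matrix.mul_add,
        Matrix.one_mul, Matrix.mul_one, Matrix.smul_mul, Matrix.mul_smul, smul_smul, smul_add]
      rw [mul_comm w z, hzw, one_smul]
      abel
    rw [e1, ← h0, ← h1, ← h1']
    simp only [transpose_sub, transpose_one, transpose_smul, Matrix.sub_mul, Matrix.mul_sub,
        Matrix.one_mul, Matrix.mul_one, Matrix.smul_mul, Matrix.mul_smul, smul_smul, smul_sub]
    rw [mul_comm w z, hzw]
    simp only [one_smul]
    abel
  have hwT : IsUnit ((1 - w • F)ᵀ).det := by rwa [det_transpose]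
  rw [Matrix.mul_assoc _ (1 + z • Θ) S, Matrix.mul_assoc _ ((1 + z • Θ) * S), key,
    transpose_mul, transpose_nonsing_inv]
  simp only [Matrix.mul_add, Matrix.add_mul, Matrix.mul_smul, Matrix.smul_mul]
  congr 1
  · congr 1
    · rw [← Matrix.mul_assoc, ← Matrix.mul_assoc, nonsing_inv_mul _ hz, Matrix.one_mul,
        Matrix.mul_assoc, mul_nonsing_inv _ hwT, Matrix.mul_one]
    · rw [← Matrix.mul_assoc, Matrix.mul_assoc, mul_nonsing_inv _ hwT, Matrix.mul_one]
  · rw [← Matrix.mul_assoc, nonsing_inv_mul _ hz, Matrix.one_mul]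

lemma map_ofReal_pow_mul_apply (A B : Matrix (Fin n) (Fin n) ℝ) (k : ℕ) (i j : Fin n) :
    ((A.map Complex.ofReal) ^ k * B.map Complex.ofReal) i j = ((A ^ k * B) i j : ℝ) := by
  rw [map_ofReal_pow]
  exact (congrFun (congrFun (Matrix.map_mul (f := Complex.ofRealHom) (L := A ^ k) (M := B)) i)
    j).symm

/-- Under the symmetry assumption all autocovariances are symmetric. -/
theorem Param.SymmetricCovariance.pow_mul_symm {ξ : Param n} (hs : ξ.SymmetricCovariance)
    (hc : ξ.CausalInvertible) {G₀ G₁ : Matrix (Fin n) (Fin n) ℝ}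
    (h0 : G₀ + ξ.Phi * G₀ * ξ.Phiᵀ - G₁ * ξ.Phiᵀ - ξ.Phi * G₁ᵀ =
      ξ.SigmaEps + ξ.Theta * ξ.SigmaEps * ξ.Thetaᵀ)
    (h1 : G₁ - ξ.Phi * G₀ = ξ.Theta * ξ.SigmaEps)
    (h1' : G₁ᵀ - G₀ * ξ.Phiᵀ = ξ.SigmaEps * ξ.Thetaᵀ) (k : ℕ) :
    (ξ.Phi ^ k * G₁)ᵀ = ξ.Phi ^ k * G₁ := by
  set F := ξ.Phi.map Complex.ofReal with hF
  set D := G₁.map Complex.ofReal with hD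
  have cadd : ∀ A B : Matrix (Fin n) (Fin n) ℝ, (A + B).map Complex.ofReal =
      A.map Complex.ofReal + B.map Complex.ofReal := fun A B =>
    Matrix.map_add _ Complex.ofReal_add _ _
  have csub : ∀ A B : Matrix (Fin n) (Fin n) ℝ, (A - B).map Complex.ofReal =
      A.map Complex.ofReal - B.map Complex.ofReal := fun A B =>
    Matrix.map_sub _ Complex.ofReal_sub _ _
  have cmul : ∀ A B : Matrix (Fin n) (Fin n) ℝ, (A * B).map Complex.ofReal =
      A.map Complex.ofReal * B.map Complex.ofReal := fun A B =>
    Matrix.map_mul (f := Complex.ofRealHom)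
  have ctr : ∀ A : Matrix (Fin n) (Fin n) ℝ, Aᵀ.map Complex.ofReal = (A.map Complex.ofReal)ᵀ :=
    fun A => rfl
  have H0 := congrArg (fun M => M.map Complex.ofReal) h0
  have H1 := congrArg (fun M => M.map Complex.ofReal) h1
  have H1' := congrArg (fun M => M.map Complex.ofReal) h1'
  simp only [cadd, csub, cmul, ctr] at H0 H1 H1'
  have hpow : ∀ i j, Summable fun k => ‖(F ^ k) i j‖ := fun i j =>
    summable_norm_pow_of_det_ne_zero F (fun z hz => (hc z hz).1) i j
  have hKsum : ∀ z : ℂ, ‖z‖ = 1 → ∀ i j, HasSum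
      (fun k => z ^ (k + 1) * (F ^ k * D) i j) ((z • ((1 - z • F)⁻¹ * D)) i j) := by
    intro z hz i j
    have h2 : HasSum (fun k => (z • F) ^ k) (1 - z • F)⁻¹ := by
      refine hasSum_pow_inv_one_sub fun i j => Summable.of_norm ?_
      simpa [smul_pow, hz] using hpow i j
    have h3 := (h2.mul_right D).const_smul z
    have h4 := Pi.hasSum.1 (Pi.hasSum.1 h3 i) j
    convert h4 using 2 with k
    simp only [smul_pow, Matrix.smul_mul, smul_smul, ← pow_succ']
    rfl
  -- In the difference of the decompositions at `z` and `z⁻¹` the central term `G₀` cancels, leaving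
  -- the antisymmetric part of the causal term, itself antisymmetrized in `z ↔ z⁻¹`.
  have hsym : ∀ z : ℂ, ‖z‖ = 1 → ∀ i j,
      ((z • ((1 - z • F)⁻¹ * D)) i j - (z • ((1 - z • F)⁻¹ * D)) j i) -
        ((z⁻¹ • ((1 - z⁻¹ • F)⁻¹ * D)) i j - (z⁻¹ • ((1 - z⁻¹ • F)⁻¹ * D)) j i) = 0 := by
    intro z hz i j
    have hz0 : z ≠ 0 := fun h => by rw [h, norm_zero] at hz; exact zero_ne_one hz
    have hzi : ‖z⁻¹‖ = 1 := by rw [norm_inv, hz, inv_one]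
    have u1 := isUnit_iff_ne_zero.2 (hc z hz.le).1
    have u2 := isUnit_iff_ne_zero.2 (hc z⁻¹ hzi.le).1
    have d1 := spectral_decomposition (mul_inv_cancel₀ hz0) u1 u2 H0 H1 H1'
    have d2 := spectral_decomposition (inv_mul_cancel₀ hz0) u2 u1 H0 H1 H1'
    have h3 := hs z hz
    simp only [Param.phiPoly, Param.thetaPoly] at h3
    rw [d1, d2] at h3
    have h4 := congrFun (congrFun h3 i) j
    simp only [Matrix.add_apply, Matrix.smul_apply, Matrix.transpose_apply] at h4 ⊢
    linear_combination h4
  ext i j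
  rw [Matrix.transpose_apply]
  -- Expanded by the Neumann series, that identity is a vanishing sine series whose coefficients are
  -- the antisymmetric parts of `F^m D`.
  have hc0 : ∀ m, ((F ^ m * D) i j - (F ^ m * D) j i) = 0 := by
    refine eq_zero_of_tsum_pow_sub_inv_pow ?_ fun z hz => ?_
    · have hb : ∀ i j, Summable fun k => ‖(F ^ k * D) i j‖ := by
        intro i j
        refine Summable.of_nonneg_of_le (fun _ => norm_nonneg _) (fun k => ?_)
          (summable_sum (s := Finset.univ) fun a _ => (hpow i a).mul_right ‖D a j‖)
        rw [Matrix.mul_apply]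
        refine (norm_sum_le _ _).trans (le_of_eq ?_)
        simp only [norm_mul]
      exact Summable.of_nonneg_of_le (fun _ => norm_nonneg _) (fun k => norm_sub_le _ _)
        ((hb i j).add (hb j i))
    · have hzi : ‖z⁻¹‖ = 1 := by rw [norm_inv, hz, inv_one]
      have := (((hKsum z hz i j).sub (hKsum z hz j i)).sub
        ((hKsum z⁻¹ hzi i j).sub (hKsum z⁻¹ hzi j i)))
      rw [hsym z hz i j] at this
      have hfun : (fun k => ((F ^ k * D) i j - (F ^ k * D) j i) * (z ^ (k + 1) - z⁻¹ ^ (k + 1))) =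
          fun k => z ^ (k + 1) * (F ^ k * D) i j - z ^ (k + 1) * (F ^ k * D) j i -
            (z⁻¹ ^ (k + 1) * (F ^ k * D) i j - z⁻¹ ^ (k + 1) * (F ^ k * D) j i) := by
        funext k
        ring
      rwa [hfun]
  have := hc0 k
  rw [map_ofReal_pow_mul_apply, map_ofReal_pow_mul_apply, sub_eq_zero] at this
  exact_mod_cast this.symm

end Symmetry

/-! ### Positive definiteness of the prediction covariances -/

section PosDef

variable {n : ℕ}

/-- By the Woodbury identity this matrix is the inverse of `S⁻¹ + ΘᵀM⁻¹Θ`, which is visibly positive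
definite. -/
lemma posDef_sub_mul_inv_mul {S M : Matrix (Fin n) (Fin n) ℝ} (Θ : Matrix (Fin n) (Fin n) ℝ)
    (hS : S.PosDef) (hM : M.PosDef) :
    (S - S * Θᵀ * (Θ * S * Θᵀ + M)⁻¹ * (Θ * S)).PosDef := by
  have hA : (Θ * S * Θᵀ + M).PosDef := by
    have : (Θ * S * Θᵀ).PosSemidef := by
      simpa using hS.posSemidef.mul_mul_conjTranspose_same Θ
    exact hM.posSemidef_add this
  have hB : (S⁻¹ + Θᵀ * M⁻¹ * Θ).PosDef := by
    have : (Θᵀ * M⁻¹ * Θ).PosSemidef := by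
      simpa using hM.inv.posSemidef.conjTranspose_mul_mul_same Θ
    exact hS.inv.add_posSemidef this
  have hSu : IsUnit S := hS.isUnit
  have hMu : IsUnit M := hM.isUnit
  have h := Matrix.add_mul_mul_inv_eq_sub (A := S⁻¹) (U := Θᵀ) (C := M⁻¹) (V := Θ)
    hS.inv.isUnit hM.inv.isUnit (by
      rw [nonsing_inv_nonsing_inv _ ((isUnit_iff_isUnit_det _).1 hSu),
        nonsing_inv_nonsing_inv _ ((isUnit_iff_isUnit_det _).1 hMu), add_comm]
      exact hA.isUnit)
  rw [nonsing_inv_nonsing_inv _ ((isUnit_iff_isUnit_det _).1 hSu),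
        nonsing_inv_nonsing_inv _ ((isUnit_iff_isUnit_det _).1 hMu), add_comm M] at h
  have h2 := hB.inv
  rw [h] at h2
  simpa only [Matrix.mul_assoc] using h2

lemma Param.predCov_succ_succ (ξ : Param n) (T t : ℕ) :
    ξ.predCov T (t + 2) =
    (if t + 2 = T then ξ.gammaY else ξ.Theta * ξ.SigmaEps * ξ.Thetaᵀ + ξ.SigmaEps) -
      ξ.coef T (t + 1) * ξ.predCov T (t + 1) * (ξ.coef T (t + 1))ᵀ := rfl

lemma Param.coef_mul_predCov (ξ : Param n) {T t : ℕ} (h : (ξ.predCov T t).PosDef) :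
    ξ.coef T t * ξ.predCov T t = ξ.SigmaEps * ξ.Thetaᵀ := by
  rw [Param.coef, nonsing_inv_mul_cancel_right _ _ ((isUnit_iff_isUnit_det _).1 h.isUnit)]

lemma Param.coef_mul_predCov_mul_coef (ξ : Param n) {T t : ℕ} (hS : ξ.SigmaEpsᵀ = ξ.SigmaEps)
    (h : (ξ.predCov T t).PosDef) :
    ξ.coef T t * ξ.predCov T t * (ξ.coef T t)ᵀ =
      ξ.SigmaEps * ξ.Thetaᵀ * (ξ.predCov T t)⁻¹ * (ξ.Theta * ξ.SigmaEps) := by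
  have hT : (ξ.predCov T t)ᵀ = ξ.predCov T t := by simpa using h.isHermitian.eq
  rw [ξ.coef_mul_predCov h, Param.coef, transpose_mul, transpose_mul, transpose_transpose, hS,
    transpose_nonsing_inv, hT]
  simp only [Matrix.mul_assoc]

/-- Positivity of `Σ_t` alone does not propagate through the recursion; positivity of the excess `M`
over `ΘΣ_εΘᵀ` does. It starts at `Σ_ε` and is updated by the Woodbury expression above. -/
lemma Param.predCov_eq_add_posDef (ξ : Param n) (hS : ξ.SigmaEps.PosDef) {T : ℕ} (t : ℕ)
    (ht : t + 1 < T) :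
    ∃ M : Matrix (Fin n) (Fin n) ℝ, M.PosDef ∧
      ξ.predCov T (t + 1) = ξ.Theta * ξ.SigmaEps * ξ.Thetaᵀ + M := by
  have hST : ξ.SigmaEpsᵀ = ξ.SigmaEps := by simpa using hS.isHermitian.eq
  have hpos : ∀ M : Matrix (Fin n) (Fin n) ℝ, M.PosDef →
      (ξ.Theta * ξ.SigmaEps * ξ.Thetaᵀ + M).PosDef := fun M hM =>
    hM.posSemidef_add (by simpa using hS.posSemidef.mul_mul_conjTranspose_same ξ.Theta)
  induction t with
  | zero => exact ⟨_, hS, rfl⟩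
  | succ t ih =>
    obtain ⟨M, hM, hEq⟩ := ih (by omega)
    refine ⟨_, posDef_sub_mul_inv_mul ξ.Theta hS hM, ?_⟩
    rw [ξ.predCov_succ_succ, if_neg (by omega),
      ξ.coef_mul_predCov_mul_coef hST (by rw [hEq]; exact hpos M hM), hEq, add_sub_assoc]

/-- All one-step prediction covariances are positive definite. -/
lemma Param.predCov_posDef (ξ : Param n) (hS : ξ.SigmaEps.PosDef)
    (hG : (ξ.gammaY - ξ.SigmaEps).PosSemidef) {T : ℕ} (hT : 2 ≤ T) {t : ℕ} (ht1 : 1 ≤ t)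
    (htT : t ≤ T) : (ξ.predCov T t).PosDef := by
  have hST : ξ.SigmaEpsᵀ = ξ.SigmaEps := by simpa using hS.isHermitian.eq
  have hpos : ∀ M : Matrix (Fin n) (Fin n) ℝ, M.PosDef →
      (ξ.Theta * ξ.SigmaEps * ξ.Thetaᵀ + M).PosDef := fun M hM =>
    hM.posSemidef_add (by simpa using hS.posSemidef.mul_mul_conjTranspose_same ξ.Theta)
  rcases htT.lt_or_eq with h | rfl
  · obtain ⟨s, rfl⟩ : ∃ s, t = s + 1 := ⟨t - 1, by omega⟩
    obtain ⟨M, hM, hEq⟩ := ξ.predCov_eq_add_posDef hS s h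
    rw [hEq]
    exact hpos M hM
  · obtain ⟨s, rfl⟩ : ∃ s, t = s + 2 := ⟨t - 2, by omega⟩
    obtain ⟨M, hM, hEq⟩ := ξ.predCov_eq_add_posDef hS (T := s + 2) s (by omega)
    rw [ξ.predCov_succ_succ, if_pos rfl,
      ξ.coef_mul_predCov_mul_coef hST (by rw [hEq]; exact hpos M hM), hEq]
    -- At the final time `Γ_Y(0)` is split as `Σ_ε + (Γ_Y(0) - Σ_ε)`: a Woodbury expression plus a
    -- positive semidefinite matrix.
    have := (posDef_sub_mul_inv_mul ξ.Theta hS hM).add_posSemidef hG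
    convert this using 1
    abel

end PosDef

end VARMA

namespace VARMA

/-! ### The explicit innovations satisfy a one-step recursion -/

section Recursion

variable {n T : ℕ}

lemma Param.C_zero (ξ : Param n) (T t : ℕ) : ξ.C T 0 (t + 1) = ξ.coef T t := by
  simp [Param.C, pow_mul]

/-- Raising both indices prepends one factor and raises the exponent `2t - j` by one, hence the
sign. The bound on `j` keeps the natural-number subtraction exact. -/
lemma Param.C_succ (ξ : Param n) (T : ℕ) {j t : ℕ} (hj : j ≤ 2 * t) :
    ξ.C T (j + 1) (t + 1) = -(ξ.coef T t * ξ.C T j t) := by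
  have hsign : (-1 : ℝ) ^ (2 * (t + 1) - (j + 1)) = -(-1) ^ (2 * t - j) := by
    rw [show 2 * (t + 1) - (j + 1) = (2 * t - j) + 1 by omega, pow_succ]
    ring
  rw [Param.C, Param.C, hsign, List.range_succ_eq_map, List.map_cons, List.prod_cons,
    List.map_map, Matrix.mul_smul, neg_smul]
  have hfun : (fun k => ξ.coef T (t + 1 - 1 - k)) ∘ Nat.succ = fun k => ξ.coef T (t - 1 - k) := by
    funext k
    simp only [Function.comp_apply]
    congr 1
    omega
  rw [hfun]
  rfl

/-- The innovation formula valid before the final time. -/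
noncomputable def innerInnov (ξ : Param n) (y : Data n T) (t : ℕ) : Fin n → ℝ :=
  alpha ξ y t - ξ.Phi *ᵥ beta y t +
      ∑ j ∈ Finset.range (t - 1), ξ.C T j t *ᵥ (ξ.Phi *ᵥ beta y (t - 1 - j))

lemma alpha_succ (ξ : Param n) (y : Data n T) {t : ℕ} (ht : 1 ≤ t) :
    alpha ξ y (t + 1) = obs y (t + 1) - ξ.coef T t *ᵥ alpha ξ y t := by
  obtain ⟨s, rfl⟩ : ∃ s, t = s + 1 := ⟨t - 1, by omega⟩
  rfl

/-- The `j = 0` term supplies `Θ_{t,1}Φβ_t`, and the later terms are `-Θ_{t,1}` times the sum at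
time `t`; with the recursion of `α` they assemble into `-Θ_{t,1}R_t`. -/
lemma innerInnov_succ (ξ : Param n) (y : Data n T) {t : ℕ} (ht : 1 ≤ t) :
    innerInnov ξ y (t + 1) =
      obs y (t + 1) - ξ.Phi *ᵥ obs y (t + 2) - ξ.coef T t *ᵥ innerInnov ξ y t := by
  obtain ⟨s, rfl⟩ : ∃ s, t = s + 1 := ⟨t - 1, by omega⟩
  have hsum : ∑ j ∈ Finset.range s,
      ξ.C T (j + 1) (s + 1 + 1) *ᵥ (ξ.Phi *ᵥ beta y (s + 1 + 1 - 1 - (j + 1))) =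
      -(ξ.coef T (s + 1) *ᵥ ∑ j ∈ Finset.range s,
        ξ.C T j (s + 1) *ᵥ (ξ.Phi *ᵥ beta y (s + 1 - 1 - j))) := by
    rw [← Matrix.mulVec_neg, ← Finset.sum_neg_distrib, Matrix.mulVec_sum]
    refine Finset.sum_congr rfl fun j hj => ?_
    have hj' := Finset.mem_range.1 hj
    rw [ξ.C_succ T (by omega), Matrix.neg_mulVec, Matrix.mulVec_neg, Matrix.mulVec_mulVec,
      show s + 1 + 1 - 1 - (j + 1) = s + 1 - 1 - j by omega]
    simp only [Matrix.mulVec_mulVec, Matrix.mul_assoc]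
  rw [innerInnov, innerInnov, alpha_succ ξ y ht, show s + 1 + 1 - 1 = s + 1 from rfl,
    Finset.sum_range_succ', show s + 1 - 1 = s from rfl, ξ.C_zero]
  rw [show s + 1 + 1 - 1 = s + 1 from rfl, show s + 1 - 1 = s from rfl] at hsum
  rw [hsum, Matrix.mulVec_add, Matrix.mulVec_sub, beta, beta]
  simp only [Nat.sub_zero]
  abel

lemma innov_eq_innerInnov (ξ : Param n) (y : Data n T) {t : ℕ} (ht1 : 1 ≤ t) (ht : t < T) :
    innov ξ y t = innerInnov ξ y t := by
  unfold innov
  split_ifs with h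
  · subst h
    simp [innerInnov]
  · rfl

lemma innov_one (ξ : Param n) (y : Data n T) (hT : 2 ≤ T) :
    innov ξ y 1 = forward ξ y 1 := by
  rw [innov, if_pos rfl, forward, if_pos (by omega)]
  rfl

/-- The separate formula at time `T` obeys the same recursion because `W_T = Y_T` has no `Φ` term.
Together with `innov_one`, this is the form in which the closed formulas are used from here on. -/
lemma innov_succ (ξ : Param n) (y : Data n T) {t : ℕ} (ht1 : 1 ≤ t) (ht : t + 1 ≤ T) :
    innov ξ y (t + 1) = forward ξ y (t + 1) - ξ.coef T t *ᵥ innov ξ y t := by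
  rw [innov_eq_innerInnov ξ y ht1 (by omega)]
  rcases ht.lt_or_eq with h | rfl
  · rw [innov_eq_innerInnov ξ y (by omega) h, innerInnov_succ ξ y ht1, forward, if_pos h]
  · rw [innov, if_neg (by omega), if_neg (lt_irrefl _), forward, if_neg (lt_irrefl _),
      alpha_succ ξ y ht1, innerInnov, Matrix.mulVec_add, Matrix.mulVec_sub,
      show t + 1 - 1 = t from rfl, show t + 1 - 2 = t - 1 by omega]
    abel

lemma forward_sub_predictor (ξ : Param n) (y : Data n T) (hT : 2 ≤ T) {t : ℕ} (ht1 : 1 ≤ t)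
    (ht : t ≤ T) : forward ξ y t - predictor ξ y t = innov ξ y t := by
  obtain ⟨s, rfl⟩ : ∃ s, t = s + 1 := ⟨t - 1, by omega⟩
  rcases Nat.eq_zero_or_pos s with rfl | hs
  · simp [predictor, innov_one ξ y hT]
  · rw [predictor, if_neg (by omega), innov_succ ξ y hs ht, show s + 1 - 1 = s from rfl]

end Recursion

/-! ### Innovations as a linear map of the data: quadratic form and determinant -/

section Linear

variable {n T : ℕ}

/-- `obs` at a fixed time as a linear map. -/
def obsLin (n T t : ℕ) : Data n T →ₗ[ℝ] (Fin n → ℝ) :=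
  if h : 1 ≤ t ∧ t ≤ T then LinearMap.proj (⟨t - 1, by omega⟩ : Fin T) else 0

lemma obsLin_apply (t : ℕ) (y : Data n T) : obsLin n T t y = obs y t := by
  unfold obsLin obs
  split_ifs <;> rfl

/-- `forward` at a fixed time as a linear map. -/
noncomputable def forwardLin (ξ : Param n) (T t : ℕ) : Data n T →ₗ[ℝ] (Fin n → ℝ) :=
  if t < T then obsLin n T t - ξ.Phi.mulVecLin ∘ₗ obsLin n T (t + 1) else obsLin n T t

lemma forwardLin_apply (ξ : Param n) (t : ℕ) (y : Data n T) :
    forwardLin ξ T t y = forward ξ y t := by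
  unfold forwardLin forward
  split_ifs <;> simp [obsLin_apply]

/-- The innovations as linear maps, through their recursion. -/
noncomputable def innovLin (ξ : Param n) (T : ℕ) : ℕ → Data n T →ₗ[ℝ] (Fin n → ℝ)
  | 0 => 0
  | 1 => forwardLin ξ T 1
  | t + 2 => forwardLin ξ T (t + 2) - (ξ.coef T (t + 1)).mulVecLin ∘ₗ innovLin ξ T (t + 1)

lemma innovLin_apply (ξ : Param n) (hT : 2 ≤ T) (y : Data n T) {t : ℕ} (ht1 : 1 ≤ t)
    (ht : t ≤ T) : innovLin ξ T t y = innov ξ y t := by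
  induction t, ht1 using Nat.le_induction with
  | base => rw [innovLin, forwardLin_apply, innov_one ξ y hT]
  | succ t ht1 ih =>
    obtain ⟨s, rfl⟩ : ∃ s, t = s + 1 := ⟨t - 1, by omega⟩
    rw [innovLin, LinearMap.sub_apply, LinearMap.comp_apply, ih (by omega), forwardLin_apply,
      Matrix.mulVecLin_apply, innov_succ ξ y ht1 ht]

/-- Quadratic forms in the data are measurable functions of the statistic. -/
lemma exists_measurable_comp_stat (B : LinearMap.BilinForm ℝ (Data n T)) :
    ∃ H : Stat n T → ℝ, Measurable H ∧ ∀ y, H (stat y) = B y y := by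
  -- The product `y_a y_bᵀ` is recorded at the later of the two times with lag `|a - b|`; when `b`
  -- is later, the entry is read transposed.
  let G : Stat n T → Fin T → Fin n → Fin T → Fin n → ℝ := fun s a i b k =>
    if b ≤ a then s a ⟨(a : ℕ) - (b : ℕ), by omega⟩ i k
    else s b ⟨(b : ℕ) - (a : ℕ), by omega⟩ k i
  have hG : ∀ y a i b k, G (stat y) a i b k = y a i * y b k := by
    intro y a i b k
    simp only [G]
    split_ifs with h
    · have h' : (b : ℕ) ≤ a := h
      simp only [stat]
      congr 3
      omega
    · have h' : (a : ℕ) ≤ b := by have : ¬ ((b : ℕ) ≤ a) := h; omega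
      simp only [stat]
      rw [mul_comm]
      congr 3
      omega
  have hGm : ∀ a i b k, Measurable fun s => G s a i b k := by
    intro a i b k
    simp only [G]
    split_ifs <;> fun_prop
  refine ⟨fun s => ∑ a, ∑ i, ∑ b, ∑ k,
    B (Pi.single b (Pi.single k 1)) (Pi.single a (Pi.single i 1)) * G s a i b k, ?_, fun y => ?_⟩
  · exact Finset.measurable_sum _ fun a _ => Finset.measurable_sum _ fun i _ =>
      Finset.measurable_sum _ fun b _ => Finset.measurable_sum _ fun k _ =>
        (hGm a i b k).const_mul _
  · simp only [hG]
    conv_rhs => rw [eq_sum_smul_single y]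
    simp only [map_sum, map_smul, LinearMap.sum_apply, LinearMap.smul_apply, smul_eq_mul,
      Finset.mul_sum]
    refine Finset.sum_congr rfl fun a _ => Finset.sum_congr rfl fun i _ =>
      Finset.sum_congr rfl fun b _ => Finset.sum_congr rfl fun k _ => ?_
    ring

lemma exists_quadratic_statistic (ξ : Param n) (hT : 2 ≤ T) :
    ∃ H : Stat n T → ℝ, Measurable H ∧ ∀ y : Data n T, H (stat y) =
      ∑ t ∈ Finset.Icc 1 T, innov ξ y t ⬝ᵥ ((ξ.predCov T t)⁻¹ *ᵥ innov ξ y t) := by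
  obtain ⟨H, hH, h⟩ := exists_measurable_comp_stat (n := n) (T := T)
    (∑ t ∈ Finset.Icc 1 T, (Matrix.toLinearMap₂' ℝ (ξ.predCov T t)⁻¹).compl₁₂
      (innovLin ξ T t) (innovLin ξ T t))
  refine ⟨H, hH, fun y => ?_⟩
  rw [h, LinearMap.sum_apply, LinearMap.sum_apply]
  refine Finset.sum_congr rfl fun t ht => ?_
  obtain ⟨h1, h2⟩ := Finset.mem_Icc.1 ht
  rw [LinearMap.compl₁₂_apply, Matrix.toLinearMap₂'_apply', innovLin_apply ξ hT y h1 h2]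

/-- The transformation of the data into its innovations. -/
noncomputable def innovMap (ξ : Param n) (T : ℕ) : Data n T →ₗ[ℝ] Data n T :=
  LinearMap.pi fun k => innovLin ξ T ((k : ℕ) + 1)

lemma innovMap_apply (ξ : Param n) (hT : 2 ≤ T) (y : Data n T) (k : Fin T) :
    innovMap ξ T y k = innov ξ y ((k : ℕ) + 1) :=
  innovLin_apply ξ hT y (by omega) (by omega)

/-- The characteristic polynomial of a nilpotent map is a power of `X`; evaluate it at `1`. -/
lemma det_one_sub_of_isNilpotent {V : Type*} [AddCommGroup V] [Module ℝ V] [FiniteDimensional ℝ V]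
    {N : V →ₗ[ℝ] V} (hN : IsNilpotent N) : LinearMap.det (1 - N) = 1 := by
  have h := LinearMap.eval_charpoly N 1
  rw [(LinearMap.charpoly_eq_X_pow_iff N).2 fun m => hN.imp fun k hk => by rw [hk]; rfl, map_one] at h
  simpa using h.symm

/-- Both `R_t + Θ_{t-1,1}R_{t-1}` and `Y_t - ΦY_{t+1}` equal `W_t`, so `(1 - N₁) ∘ innovMap = 1 -
N₂`, where `N₁` looks one step back and `N₂` one step ahead. Both are nilpotent. -/
lemma det_innovMap (ξ : Param n) (hT : 2 ≤ T) : LinearMap.det (innovMap ξ T) = 1 := by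
  -- Component `k` is time `k + 1`, so `k + 2` is the next time and `k` the previous one. The ends
  -- take care of themselves: `obs` vanishes at times `0` and `T + 1`.
  let N₂ : Data n T →ₗ[ℝ] Data n T :=
    LinearMap.pi fun k => ξ.Phi.mulVecLin ∘ₗ obsLin n T ((k : ℕ) + 2)
  let N₁ : Data n T →ₗ[ℝ] Data n T :=
    LinearMap.pi fun k => (-ξ.coef T k).mulVecLin ∘ₗ obsLin n T (k : ℕ)
  have hobs : ∀ (r : Data n T) (k : ℕ) (hk : k < T), obs r (k + 1) = r ⟨k, hk⟩ := by
    intro r k hk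
    rw [obs, dif_pos ⟨by omega, by omega⟩]
    rfl
  have h2 : IsNilpotent N₂ := by
    have : ∀ m (y : Data n T) (k : Fin T), T ≤ k + m → (N₂ ^ m) y k = 0 := by
      intro m
      induction m with
      | zero => intro y k hk; omega
      | succ m ih =>
        intro y k hk
        rw [pow_succ', Module.End.mul_apply]
        simp only [N₂, LinearMap.pi_apply, LinearMap.comp_apply, obsLin_apply]
        have : obs ((N₂ ^ m) y) ((k : ℕ) + 2) = 0 := by
          by_cases hk' : (k : ℕ) + 1 < T
          · rw [hobs _ _ hk']
            exact ih _ _ (by simp only; omega)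
          · rw [obs, dif_neg (by omega)]
        exact (congrArg _ this).trans (map_zero _)
    exact ⟨T, LinearMap.ext fun y => funext fun k => this T y k (by omega)⟩
  have h1 : IsNilpotent N₁ := by
    have : ∀ m (y : Data n T) (k : Fin T), (k : ℕ) < m → (N₁ ^ m) y k = 0 := by
      intro m
      induction m with
      | zero => intro y k hk; omega
      | succ m ih =>
        intro y k hk
        rw [pow_succ', Module.End.mul_apply]
        simp only [N₁, LinearMap.pi_apply, LinearMap.comp_apply, obsLin_apply]
        have : obs ((N₁ ^ m) y) (k : ℕ) = 0 := by
          by_cases hk' : 1 ≤ (k : ℕ)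
          · obtain ⟨j, hj⟩ : ∃ j, (k : ℕ) = j + 1 := ⟨k - 1, by omega⟩
            rw [hj, hobs _ j (by omega)]
            exact ih _ _ (by simp only; omega)
          · rw [obs, dif_neg (by omega)]
        exact (congrArg _ this).trans (map_zero _)
    exact ⟨T, LinearMap.ext fun y => funext fun k => this T y k k.2⟩
  have hcomp : (1 - N₁ : Data n T →ₗ[ℝ] Data n T) ∘ₗ innovMap ξ T = 1 - N₂ := by
    refine LinearMap.ext fun y => funext fun k => ?_
    have e1 : (1 - N₂) y k = forward ξ y ((k : ℕ) + 1) := by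
      have : (1 - N₂) y k = y k - ξ.Phi *ᵥ obs y ((k : ℕ) + 2) := by
        simp [N₂, obsLin_apply]
      rw [this, forward, hobs y k k.2]
      split_ifs with h
      · rfl
      · rw [obs, dif_neg (by omega), Matrix.mulVec_zero, sub_zero]
    have e2 : ((1 - N₁ : Data n T →ₗ[ℝ] Data n T) ∘ₗ innovMap ξ T) y k =
        innov ξ y ((k : ℕ) + 1) + ξ.coef T k *ᵥ obs (innovMap ξ T y) (k : ℕ) := by
      simp [N₁, obsLin_apply, innovMap_apply ξ hT]
    rw [e1, e2]
    rcases Nat.eq_zero_or_pos (k : ℕ) with h0 | h0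
    · rw [h0, innov_one ξ y hT, obs, dif_neg (by omega), Matrix.mulVec_zero, add_zero]
    · obtain ⟨j, hj⟩ : ∃ j, (k : ℕ) = j + 1 := ⟨k - 1, by omega⟩
      have hobs' : obs (innovMap ξ T y) (k : ℕ) = innov ξ y (k : ℕ) := by
        rw [hj, hobs _ j (by omega), innovMap_apply ξ hT]
      rw [hobs', innov_succ ξ y h0 (by omega), sub_add_cancel]
  have := congrArg LinearMap.det hcomp
  rwa [LinearMap.det_comp, det_one_sub_of_isNilpotent h1, det_one_sub_of_isNilpotent h2,
    one_mul] at this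

end Linear

end VARMA

namespace VARMA

open Filter Topology

/-! ### Calculus of second-moment matrices -/

section Cross

variable {n : ℕ} {Ω : Type*} [MeasurableSpace Ω] {P : Measure Ω}

/-- Componentwise square-integrability of a random vector. -/
def SqInt (P : Measure Ω) (X : Ω → Fin n → ℝ) : Prop := ∀ i, MemLp (fun ω => X ω i) 2 P

/-- The matrix `E[X Zᵀ]` of second moments. -/
noncomputable def cross (P : Measure Ω) (X Z : Ω → Fin n → ℝ) : Matrix (Fin n) (Fin n) ℝ :=
  Matrix.of fun i j => ∫ ω, X ω i * Z ω j ∂P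

lemma SqInt.add {X Z : Ω → Fin n → ℝ} (hX : SqInt P X) (hZ : SqInt P Z) :
    SqInt P fun ω => X ω + Z ω := fun i => (hX i).add (hZ i)

lemma SqInt.sub {X Z : Ω → Fin n → ℝ} (hX : SqInt P X) (hZ : SqInt P Z) :
    SqInt P fun ω => X ω - Z ω := fun i => (hX i).sub (hZ i)

lemma SqInt.mulVec {X : Ω → Fin n → ℝ} (hX : SqInt P X) (A : Matrix (Fin n) (Fin n) ℝ) :
    SqInt P fun ω => A *ᵥ X ω := fun i => by
  simp only [Matrix.mulVec, dotProduct]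
  exact memLp_finsetSum _ fun j _ => (hX j).const_mul _

lemma SqInt.sum {ι : Type*} {s : Finset ι} {X : ι → Ω → Fin n → ℝ}
    (hX : ∀ k ∈ s, SqInt P (X k)) : SqInt P fun ω => ∑ k ∈ s, X k ω := fun i => by
  simp only [Finset.sum_apply]
  exact memLp_finsetSum _ fun k hk => hX k hk i

lemma SqInt.integrable_mul {X Z : Ω → Fin n → ℝ} (hX : SqInt P X) (hZ : SqInt P Z) (i j : Fin n) :
    Integrable (fun ω => X ω i * Z ω j) P := (hX i).integrable_mul (hZ j)

lemma cross_transpose (X Z : Ω → Fin n → ℝ) : (cross P X Z)ᵀ = cross P Z X := by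
  ext i j
  simp only [cross, Matrix.transpose_apply, Matrix.of_apply, mul_comm]

lemma cross_congr {X X' Z Z' : Ω → Fin n → ℝ} (hX : X =ᵐ[P] X') (hZ : Z =ᵐ[P] Z') :
    cross P X Z = cross P X' Z' := by
  ext i j
  refine integral_congr_ae ?_
  filter_upwards [hX, hZ] with ω h1 h2
  rw [h1, h2]

lemma cross_add_left {X X' Z : Ω → Fin n → ℝ} (hX : SqInt P X) (hX' : SqInt P X')
    (hZ : SqInt P Z) : cross P (fun ω => X ω + X' ω) Z = cross P X Z + cross P X' Z := by
  ext i j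
  simp only [cross, Matrix.of_apply, Matrix.add_apply, Pi.add_apply, add_mul]
  exact integral_add (hX.integrable_mul hZ i j) (hX'.integrable_mul hZ i j)

lemma cross_sub_left {X X' Z : Ω → Fin n → ℝ} (hX : SqInt P X) (hX' : SqInt P X')
    (hZ : SqInt P Z) : cross P (fun ω => X ω - X' ω) Z = cross P X Z - cross P X' Z := by
  ext i j
  simp only [cross, Matrix.of_apply, Matrix.sub_apply, Pi.sub_apply, sub_mul]
  exact integral_sub (hX.integrable_mul hZ i j) (hX'.integrable_mul hZ i j)

lemma cross_mulVec_left {X Z : Ω → Fin n → ℝ} (hX : SqInt P X) (hZ : SqInt P Z)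
    (A : Matrix (Fin n) (Fin n) ℝ) : cross P (fun ω => A *ᵥ X ω) Z = A * cross P X Z := by
  ext i j
  simp only [cross, Matrix.of_apply, Matrix.mul_apply, Matrix.mulVec, dotProduct, Finset.sum_mul]
  rw [integral_finsetSum _ fun k _ => ?_]
  · simp only [mul_assoc, integral_const_mul]
  · simp only [mul_assoc]
    exact (hX.integrable_mul hZ k j).const_mul _

lemma cross_add_right {X Z Z' : Ω → Fin n → ℝ} (hX : SqInt P X) (hZ : SqInt P Z)
    (hZ' : SqInt P Z') : cross P X (fun ω => Z ω + Z' ω) = cross P X Z + cross P X Z' := by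
  rw [← cross_transpose, cross_add_left hZ hZ' hX, transpose_add, cross_transpose, cross_transpose]

lemma cross_sub_right {X Z Z' : Ω → Fin n → ℝ} (hX : SqInt P X) (hZ : SqInt P Z)
    (hZ' : SqInt P Z') : cross P X (fun ω => Z ω - Z' ω) = cross P X Z - cross P X Z' := by
  rw [← cross_transpose, cross_sub_left hZ hZ' hX, transpose_sub, cross_transpose, cross_transpose]

lemma cross_mulVec_right {X Z : Ω → Fin n → ℝ} (hX : SqInt P X) (hZ : SqInt P Z)
    (A : Matrix (Fin n) (Fin n) ℝ) : cross P X (fun ω => A *ᵥ Z ω) = cross P X Z * Aᵀ := by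
  rw [← cross_transpose, cross_mulVec_left hZ hX, transpose_mul, cross_transpose]

lemma cross_sum_right {ι : Type*} {s : Finset ι} {X : Ω → Fin n → ℝ} {Z : ι → Ω → Fin n → ℝ}
    (hX : SqInt P X) (hZ : ∀ k ∈ s, SqInt P (Z k)) :
    cross P X (fun ω => ∑ k ∈ s, Z k ω) = ∑ k ∈ s, cross P X (Z k) := by
  ext i j
  simp only [cross, Matrix.of_apply, Finset.sum_apply, Matrix.sum_apply, Finset.mul_sum]
  exact integral_finsetSum _ fun k hk => hX.integrable_mul (hZ k hk) i j

lemma dotProduct_cross_mulVec {X : Ω → Fin n → ℝ} (hX : SqInt P X) (v : Fin n → ℝ) :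
    v ⬝ᵥ cross P X X *ᵥ v = ∫ ω, (∑ i, v i * X ω i) * ∑ j, v j * X ω j ∂P := by
  simp_rw [Finset.sum_mul_sum]
  simp only [dotProduct, Matrix.mulVec, cross, Matrix.of_apply, Finset.mul_sum]
  have hint : ∀ i j, Integrable (fun ω => v i * X ω i * (v j * X ω j)) P := fun i j => by
    have := (hX.integrable_mul hX i j).const_mul (v i * v j)
    refine this.congr (ae_of_all _ fun ω => ?_)
    simp only
    ring
  rw [integral_finsetSum _ fun i _ => integrable_finsetSum _ fun j _ => hint i j]
  refine Finset.sum_congr rfl fun i _ => ?_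
  rw [integral_finsetSum _ fun j _ => hint i j]
  refine Finset.sum_congr rfl fun j _ => ?_
  rw [← mul_assoc, mul_comm (v i * _), ← mul_assoc, ← integral_const_mul]
  refine integral_congr_ae (ae_of_all _ fun ω => ?_)
  simp only
  ring

lemma cross_self_posSemidef {X : Ω → Fin n → ℝ} (hX : SqInt P X) : (cross P X X).PosSemidef := by
  rw [Matrix.posSemidef_iff_dotProduct_mulVec]
  refine ⟨?_, fun v => ?_⟩
  · rw [Matrix.IsHermitian, conjTranspose_eq_transpose_of_trivial, cross_transpose]
  · rw [star_trivial, dotProduct_cross_mulVec hX]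
    exact integral_nonneg fun ω => mul_self_nonneg _

/-- From `|xz| ≤ (x² + z²)/2`. Its role is to bound cross moments uniformly in time, using
stationarity. -/
lemma abs_cross_le {X Z : Ω → Fin n → ℝ} (hX : SqInt P X) (hZ : SqInt P Z) (i j : Fin n) :
    |cross P X Z i j| ≤ (cross P X X i i + cross P Z Z j j) / 2 := by
  simp only [cross, Matrix.of_apply]
  rw [← integral_add (hX.integrable_mul hX i i) (hZ.integrable_mul hZ j j), ← integral_div]
  refine (abs_integral_le_integral_abs).trans (integral_mono (hX.integrable_mul hZ i j).abs
    (((hX.integrable_mul hX i i).add (hZ.integrable_mul hZ j j)).div_const 2) fun ω => ?_)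
  simp only
  rw [abs_le]
  constructor <;> nlinarith [sq_nonneg (X ω i + Z ω j), sq_nonneg (X ω i - Z ω j)]

end Cross

namespace IsProcess

variable {n : ℕ} {Ω : Type u} [MeasurableSpace Ω] {P : Measure Ω}
  {ξ : Param n} {Y ε : ℤ → Ω → Fin n → ℝ}

/-! ### Second moments of the noise -/

section Noise

lemma sqInt (h : IsProcess P ξ Y ε) (t : ℤ) : SqInt P (Y t) := fun i =>
  (memLp_pi_iff.1 (h.memLp t)) i

lemma hasGaussianLaw_noise (h : IsProcess P ξ Y ε) (t : ℤ) : HasGaussianLaw (ε t) P := by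
  have h1 : HasGaussianLaw (fun ω => WithLp.toLp 2 (ε t ω)) P := ⟨by
    rw [h.law_noise t]; infer_instance⟩
  exact h1.map_equiv_fun (PiLp.continuousLinearEquiv 2 ℝ fun _ : Fin n => ℝ)

lemma sqInt_noise (h : IsProcess P ξ Y ε) (t : ℤ) : SqInt P (ε t) := fun i =>
  ((h.hasGaussianLaw_noise t).map_fun (ContinuousLinearMap.proj i)).memLp_two

lemma integral_noise (h : IsProcess P ξ Y ε) (t : ℤ) (i : Fin n) : ∫ ω, ε t ω i ∂P = 0 := by
  have hm : Measurable fun ω => WithLp.toLp 2 (ε t ω) :=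
    (WithLp.measurable_toLp 2 _).comp (h.measurable_noise t)
  have h1 : ∫ ω, ε t ω i ∂P =
      ∫ x, (EuclideanSpace.proj i : EuclideanSpace ℝ (Fin n) →L[ℝ] ℝ) x
        ∂(multivariateGaussian 0 ξ.SigmaEps) := by
    rw [← h.law_noise t, integral_map hm.aemeasurable (by fun_prop)]
    rfl
  have h2 := IsGaussian.integral_dual (μ := multivariateGaussian 0 ξ.SigmaEps)
    (EuclideanSpace.proj i : EuclideanSpace ℝ (Fin n) →L[ℝ] ℝ)
  rw [integral_id_multivariateGaussian, map_zero] at h2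
  exact h1.trans h2

lemma cross_noise_self (h : IsProcess P ξ Y ε) (hS : ξ.SigmaEps.PosSemidef) (t : ℤ) :
    cross P (ε t) (ε t) = ξ.SigmaEps := by
  have := (h.hasGaussianLaw_noise t).isProbabilityMeasure
  ext i j
  have hm : Measurable fun ω => WithLp.toLp 2 (ε t ω) :=
    (WithLp.measurable_toLp 2 _).comp (h.measurable_noise t)
  have h1 := covariance_eval_multivariateGaussian (μ := 0) hS i j
  rw [← h.law_noise t, covariance_map (by fun_prop) (by fun_prop) hm.aemeasurable] at h1
  have h2 : cov[fun ω => ε t ω i, fun ω => ε t ω j; P] = ξ.SigmaEps i j := h1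
  rw [covariance_eq_sub (h.sqInt_noise t i) (h.sqInt_noise t j), h.integral_noise,
    zero_mul, sub_zero] at h2
  exact h2

lemma cross_noise_of_ne (h : IsProcess P ξ Y ε) {s t : ℤ} (hst : s ≠ t) :
    cross P (ε s) (ε t) = 0 := by
  ext i j
  have hind : IndepFun (fun ω => ε s ω i) (fun ω => ε t ω j) P :=
    (h.indep_noise.indepFun hst).comp (measurable_pi_apply i) (measurable_pi_apply j)
  have := hind.integral_fun_mul_eq_mul_integral (h.sqInt_noise s i).1 (h.sqInt_noise t j).1
  rw [h.integral_noise, zero_mul] at this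
  exact this

end Noise

/-! ### Autocovariance equations and the series for `Γ_Y(0)` -/

section Moments

lemma cross_shift (h : IsProcess P ξ Y ε) (s t r : ℤ) :
    cross P (Y (s + r)) (Y s) = cross P (Y (t + r)) (Y t) := by
  ext i j
  exact h.stationary s t r i j

lemma ae_eq_add (h : IsProcess P ξ Y ε) (t : ℤ) :
    Y t =ᵐ[P] fun ω => ξ.Phi *ᵥ Y (t - 1) ω + (ε t ω + ξ.Theta *ᵥ ε (t - 1) ω) := by
  filter_upwards [h.equation t] with ω hω
  rw [← hω]
  abel

lemma cross_noise_add (h : IsProcess P ξ Y ε) (s t : ℤ) :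
    cross P (ε s) (Y t) = cross P (ε s) (Y (t - 1)) * ξ.Phiᵀ +
      (cross P (ε s) (ε t) + cross P (ε s) (ε (t - 1)) * ξ.Thetaᵀ) := by
  have hs := h.sqInt_noise
  have hY := h.sqInt
  rw [cross_congr (Filter.EventuallyEq.refl _ _) (h.ae_eq_add t),
    cross_add_right (hs s) ((hY _).mulVec _) ((hs t).add ((hs _).mulVec _)),
    cross_mulVec_right (hs s) (hY _), cross_add_right (hs s) (hs t) ((hs _).mulVec _),
    cross_mulVec_right (hs s) (hs _)]

/-- Future noise is uncorrelated with the process. -/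
lemma cross_noise_of_lt (h : IsProcess P ξ Y ε) (hc : ξ.CausalInvertible) {s t : ℤ} (hst : t < s) :
    cross P (ε s) (Y t) = 0 := by
  -- The equation is iterated into the past; every noise term met there precedes `s` and is
  -- uncorrelated with `ε_s`.
  have hiter : ∀ N : ℕ, cross P (ε s) (Y t) = cross P (ε s) (Y (t - N)) * (ξ.Phi ^ N)ᵀ := by
    intro N
    induction N with
    | zero => simp
    | succ N ih =>
      rw [ih, h.cross_noise_add s (t - N), h.cross_noise_of_ne (by omega),
        h.cross_noise_of_ne (by omega), Matrix.zero_mul, add_zero, add_zero, Matrix.mul_assoc,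
        ← transpose_mul, ← pow_succ, sub_sub]
      push_cast
      rfl
  ext i j
  have hbound : ∀ N : ℕ, |cross P (ε s) (Y t) i j| ≤
      ∑ k, (cross P (ε s) (ε s) i i + cross P (Y 0) (Y 0) k k) / 2 * |(ξ.Phi ^ N) j k| := by
    intro N
    rw [hiter N, Matrix.mul_apply]
    refine (Finset.abs_sum_le_sum_abs _ _).trans (Finset.sum_le_sum fun k _ => ?_)
    rw [abs_mul, Matrix.transpose_apply]
    gcongr
    have := abs_cross_le (h.sqInt_noise s) (h.sqInt (t - N)) i k
    have hsh := h.cross_shift (t - N) 0 0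
    simp only [add_zero] at hsh
    rwa [hsh] at this
  have hlim : Tendsto (fun N : ℕ => ∑ k, (cross P (ε s) (ε s) i i + cross P (Y 0) (Y 0) k k) / 2 *
      |(ξ.Phi ^ N) j k|) atTop (𝓝 0) := by
    have : (0 : ℝ) = ∑ k : Fin n, (cross P (ε s) (ε s) i i + cross P (Y 0) (Y 0) k k) / 2 * |0| := by
      simp
    rw [this]
    exact tendsto_finsetSum _ fun k _ => ((hc.tendsto_pow j k).abs).const_mul _
  have := ge_of_tendsto' hlim hbound
  exact abs_nonpos_iff.1 this

lemma cross_noise_same (h : IsProcess P ξ Y ε) (hc : ξ.CausalInvertible)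
    (hS : ξ.SigmaEps.PosSemidef) (t : ℤ) : cross P (ε t) (Y t) = ξ.SigmaEps := by
  rw [h.cross_noise_add t t, h.cross_noise_of_lt hc (by omega), h.cross_noise_self hS,
    h.cross_noise_of_ne (by omega), Matrix.zero_mul, Matrix.zero_mul, zero_add, add_zero]

/-- The recursion of the autocovariances. -/
lemma cross_succ (h : IsProcess P ξ Y ε) (t s : ℤ) :
    cross P (Y (t + 1)) (Y s) = ξ.Phi * cross P (Y t) (Y s) +
      (cross P (ε (t + 1)) (Y s) + ξ.Theta * cross P (ε t) (Y s)) := by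
  have hs := h.sqInt_noise
  have hY := h.sqInt
  have hae := h.ae_eq_add (t + 1)
  rw [add_sub_cancel_right] at hae
  rw [cross_congr hae (Filter.EventuallyEq.refl _ _),
    cross_add_left ((hY _).mulVec _) ((hs _).add ((hs _).mulVec _)) (hY _),
    cross_mulVec_left (hY _) (hY _), cross_add_left (hs _) ((hs _).mulVec _) (hY _),
    cross_mulVec_left (hs _) (hY _)]

lemma cross_one (h : IsProcess P ξ Y ε) (hc : ξ.CausalInvertible)
    (hS : ξ.SigmaEps.PosSemidef) :
    cross P (Y 1) (Y 0) - ξ.Phi * cross P (Y 0) (Y 0) = ξ.Theta * ξ.SigmaEps := by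
  have := h.cross_succ 0 0
  rw [zero_add, h.cross_noise_of_lt hc zero_lt_one, h.cross_noise_same hc hS, zero_add] at this
  rw [this, add_sub_cancel_left]

lemma cross_add_two (h : IsProcess P ξ Y ε) (hc : ξ.CausalInvertible) (k : ℕ) :
    cross P (Y ((k : ℤ) + 2)) (Y 0) = ξ.Phi * cross P (Y ((k : ℤ) + 1)) (Y 0) := by
  have := h.cross_succ ((k : ℤ) + 1) 0
  rw [h.cross_noise_of_lt hc (by omega), h.cross_noise_of_lt hc (by omega), Matrix.mul_zero,
    add_zero, add_zero, add_assoc] at this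
  exact this

/-- The second moment of `Y_1 - ΦY_0 = ε_1 + Θε_0`, expanded on both sides. -/
lemma cross_difference (h : IsProcess P ξ Y ε) (hS : ξ.SigmaEps.PosSemidef) :
    cross P (Y 0) (Y 0) + ξ.Phi * cross P (Y 0) (Y 0) * ξ.Phiᵀ - cross P (Y 1) (Y 0) * ξ.Phiᵀ -
      ξ.Phi * (cross P (Y 1) (Y 0))ᵀ = ξ.SigmaEps + ξ.Theta * ξ.SigmaEps * ξ.Thetaᵀ := by
  have hs := h.sqInt_noise
  have hY := h.sqInt
  have hae : (fun ω => Y 1 ω - ξ.Phi *ᵥ Y 0 ω) =ᵐ[P] fun ω => ε 1 ω + ξ.Theta *ᵥ ε 0 ω :=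
    h.equation 1
  have h1 := cross_congr hae hae
  rw [cross_sub_left (hY 1) ((hY 0).mulVec _) ((hY 1).sub ((hY 0).mulVec _)),
    cross_sub_right (hY 1) (hY 1) ((hY 0).mulVec _), cross_mulVec_left (hY 0)
      ((hY 1).sub ((hY 0).mulVec _)), cross_sub_right (hY 0) (hY 1) ((hY 0).mulVec _),
    cross_mulVec_right (hY 1) (hY 0), cross_mulVec_right (hY 0) (hY 0),
    cross_add_left (hs 1) ((hs 0).mulVec _) ((hs 1).add ((hs 0).mulVec _)),
    cross_add_right (hs 1) (hs 1) ((hs 0).mulVec _), cross_mulVec_left (hs 0)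
      ((hs 1).add ((hs 0).mulVec _)), cross_add_right (hs 0) (hs 1) ((hs 0).mulVec _),
    cross_mulVec_right (hs 1) (hs 0), cross_mulVec_right (hs 0) (hs 0),
    h.cross_noise_self hS, h.cross_noise_self hS, h.cross_noise_of_ne one_ne_zero,
    h.cross_noise_of_ne zero_ne_one, Matrix.zero_mul, zero_add, add_zero, Matrix.mul_sub,
    ← Matrix.mul_assoc, ← Matrix.mul_assoc] at h1
  have h2 := h.cross_shift 1 0 0
  simp only [add_zero] at h2
  rw [h2, ← cross_transpose (Y 1) (Y 0)] at h1
  rw [← h1]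
  abel

/-- The one-step prediction error given the infinite past. -/
lemma cross_sub_noise (h : IsProcess P ξ Y ε) (hc : ξ.CausalInvertible)
    (hS : ξ.SigmaEps.PosSemidef) (t : ℤ) :
    cross P (fun ω => Y t ω - ε t ω) (fun ω => Y t ω - ε t ω) =
      cross P (Y 0) (Y 0) - ξ.SigmaEps := by
  have hs := h.sqInt_noise t
  have hY := h.sqInt t
  have hST : ξ.SigmaEpsᵀ = ξ.SigmaEps := by simpa using hS.isHermitian.eq
  have h2 := h.cross_shift t 0 0
  simp only [add_zero] at h2
  rw [cross_sub_left hY hs (hY.sub hs), cross_sub_right hY hY hs, cross_sub_right hs hY hs,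
    h.cross_noise_self hS, h.cross_noise_same hc hS, ← cross_transpose (ε t) (Y t),
    h.cross_noise_same hc hS, hST, h2, sub_self, sub_zero]

/-- The process `U_t = Y_t - ε_t` satisfies `U_1 = ΦU_0 + (Φ + Θ)ε_0`, and `ε_0` is uncorrelated
with `U_0`. By stationarity `U_0` and `U_1` have the same second moment. -/
lemma lyapunov (h : IsProcess P ξ Y ε) (hc : ξ.CausalInvertible)
    (hS : ξ.SigmaEps.PosSemidef) :
    cross P (Y 0) (Y 0) - ξ.SigmaEps = ξ.Phi * (cross P (Y 0) (Y 0) - ξ.SigmaEps) * ξ.Phiᵀ +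
      (ξ.Phi + ξ.Theta) * ξ.SigmaEps * (ξ.Phi + ξ.Theta)ᵀ := by
  have hs := h.sqInt_noise
  have hU : ∀ t, SqInt P fun ω => Y t ω - ε t ω := fun t => (h.sqInt t).sub (hs t)
  have hae : (fun ω => Y 1 ω - ε 1 ω) =ᵐ[P] fun ω => ξ.Phi *ᵥ (Y 0 ω - ε 0 ω) +
      (ξ.Phi + ξ.Theta) *ᵥ ε 0 ω := by
    filter_upwards [h.ae_eq_add 1] with ω hω
    rw [hω, sub_self, Matrix.mulVec_sub, Matrix.add_mulVec]
    abel
  have h0 : cross P (ε 0) (fun ω => Y 0 ω - ε 0 ω) = 0 := by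
    rw [cross_sub_right (hs 0) (h.sqInt 0) (hs 0), h.cross_noise_same hc hS,
      h.cross_noise_self hS, sub_self]
  have h0' : cross P (fun ω => Y 0 ω - ε 0 ω) (ε 0) = 0 := by
    rw [← cross_transpose, h0, transpose_zero]
  have h1 := cross_congr hae hae
  rw [h.cross_sub_noise hc hS,
    cross_add_left ((hU 0).mulVec _) ((hs 0).mulVec _) (((hU 0).mulVec _).add ((hs 0).mulVec _)),
    cross_mulVec_left (hU 0) (((hU 0).mulVec _).add ((hs 0).mulVec _)),
    cross_mulVec_left (hs 0) (((hU 0).mulVec _).add ((hs 0).mulVec _)),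
    cross_add_right (hU 0) ((hU 0).mulVec _) ((hs 0).mulVec _),
    cross_add_right (hs 0) ((hU 0).mulVec _) ((hs 0).mulVec _),
    cross_mulVec_right (hU 0) (hU 0), cross_mulVec_right (hU 0) (hs 0),
    cross_mulVec_right (hs 0) (hU 0), cross_mulVec_right (hs 0) (hs 0), h0, h0',
    h.cross_sub_noise hc hS, h.cross_noise_self hS, Matrix.zero_mul, Matrix.zero_mul, zero_add,
    add_zero, ← Matrix.mul_assoc, ← Matrix.mul_assoc] at h1
  exact h1

/-- The Lyapunov equation unrolls into the terms `j ≥ 1` of the series; the missing term `j = 0` is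
`Σ_ε`. -/
lemma cross_zero_eq_gammaY (h : IsProcess P ξ Y ε) (hc : ξ.CausalInvertible)
    (hS : ξ.SigmaEps.PosSemidef) : cross P (Y 0) (Y 0) = ξ.gammaY := by
  have h1 := hasSum_pow_mul_mul_pow_transpose hc.summable_abs_pow (h.lyapunov hc hS)
  have h2 : HasSum (fun j => ξ.psi (j + 1) * ξ.SigmaEps * (ξ.psi (j + 1))ᵀ)
      (cross P (Y 0) (Y 0) - ξ.SigmaEps) := by
    have hfun : (fun j => ξ.psi (j + 1) * ξ.SigmaEps * (ξ.psi (j + 1))ᵀ) = fun k =>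
        ξ.Phi ^ k * ((ξ.Phi + ξ.Theta) * ξ.SigmaEps * (ξ.Phi + ξ.Theta)ᵀ) * (ξ.Phi ^ k)ᵀ := by
      funext k
      simp only [Param.psi, transpose_mul, Matrix.mul_assoc]
    rwa [hfun]
  have h3 := (hasSum_nat_add_iff (f := fun j => ξ.psi j * ξ.SigmaEps * (ξ.psi j)ᵀ) 1).1 h2
  simp only [Finset.sum_range_one, Param.psi, Matrix.one_mul, transpose_one, Matrix.mul_one,
    sub_add_cancel] at h3
  exact h3.tsum_eq.symm

lemma gammaY_sub_posSemidef (h : IsProcess P ξ Y ε) (hc : ξ.CausalInvertible)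
    (hS : ξ.SigmaEps.PosSemidef) : (ξ.gammaY - ξ.SigmaEps).PosSemidef := by
  rw [← h.cross_zero_eq_gammaY hc hS, ← h.cross_sub_noise hc hS 0]
  exact cross_self_posSemidef ((h.sqInt 0).sub (h.sqInt_noise 0))

end Moments

end IsProcess

end VARMA

namespace VARMA

open Filter Topology

/-! ### Gaussian vectors from their second moments -/

section GaussianVector

variable {n : ℕ} {Ω : Type*} [MeasurableSpace Ω] {P : Measure Ω}

/-- A centered Gaussian vector is determined by its second moments. -/
lemma map_eq_map_multivariateGaussian {X : Ω → Fin n → ℝ} (hX : HasGaussianLaw X P)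
    (h0 : ∀ i, ∫ ω, X ω i ∂P = 0) {S : Matrix (Fin n) (Fin n) ℝ} (hS : S.PosSemidef)
    (hcov : cross P X X = S) : P.map X = (multivariateGaussian 0 S).map WithLp.ofLp := by
  have := hX.isProbabilityMeasure
  have hXm := hX.aemeasurable
  have hsq : SqInt P X := fun i => (hX.map_fun (ContinuousLinearMap.proj i)).memLp_two
  have hXL : HasGaussianLaw (fun ω => WithLp.toLp 2 (X ω)) P :=
    hX.map_equiv_fun (PiLp.continuousLinearEquiv 2 ℝ fun _ : Fin n => ℝ).symm
  have hlaw : P.map (fun ω => WithLp.toLp 2 (X ω)) = multivariateGaussian 0 S := by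
    have := hXL.isGaussian_map
    refine Measure.ext_of_charFun (funext fun t => ?_)
    rw [hXL.charFun_map_eq, charFun_multivariateGaussian hS]
    have hin : (fun ω => inner ℝ t (WithLp.toLp 2 (X ω))) = fun ω => ∑ i, t i * X ω i := by
      funext ω
      simp [PiLp.inner_apply, mul_comm]
    have hmean : ∫ ω, ∑ i, t i * X ω i ∂P = 0 := by
      rw [integral_finsetSum _ fun i _ => ((hsq i).integrable (by norm_num)).const_mul _]
      simp [integral_const_mul, h0]
    have hm : MemLp (fun ω => ∑ i, t i * X ω i) 2 P :=
      memLp_finsetSum _ fun i _ => (hsq i).const_mul _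
    rw [hin, hmean, variance_eq_sub hm, hmean, ← hcov, dotProduct_cross_mulVec hsq]
    simp [sq]
  rw [← hlaw, AEMeasurable.map_map_of_aemeasurable (by fun_prop) (by fun_prop)]
  rfl

lemma eLpNorm_two_eq {f : Ω → ℝ} (hf : MemLp f 2 P) :
    eLpNorm f 2 P = ENNReal.ofReal (Real.sqrt (∫ ω, f ω * f ω ∂P)) := by
  rw [hf.eLpNorm_eq_integral_rpow_norm two_ne_zero ENNReal.ofNat_ne_top, Real.sqrt_eq_rpow]
  congr 2
  · refine integral_congr_ae (ae_of_all _ fun ω => ?_)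
    simp [sq]
  · norm_num

end GaussianVector

namespace IsProcess

variable {n : ℕ} {Ω : Type u} [MeasurableSpace Ω] {P : Measure Ω}
  {ξ : Param n} {Y ε : ℤ → Ω → Fin n → ℝ}

/-! ### The sample is Gaussian -/

section Sample

lemma measurable_sample (h : IsProcess P ξ Y ε) (T : ℕ) : Measurable (sample T Y) :=
  measurable_pi_lambda _ fun _ => h.measurable _

/-- The finite-order causal approximation. -/
lemma ae_eq_causal_sum (h : IsProcess P ξ Y ε) (N : ℕ) (t : ℤ) :
    Y t =ᵐ[P] fun ω => ∑ j ∈ Finset.range N,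
        ξ.Phi ^ j *ᵥ (ε (t - j) ω + ξ.Theta *ᵥ ε (t - j - 1) ω) +
      ξ.Phi ^ N *ᵥ Y (t - N) ω := by
  induction N with
  | zero => simp
  | succ N ih =>
    filter_upwards [ih, h.ae_eq_add (t - N)] with ω h1 h2
    rw [h1, Finset.sum_range_succ, h2, Matrix.mulVec_add, Matrix.mulVec_mulVec, ← pow_succ]
    push_cast
    rw [sub_sub]
    abel

lemma hasGaussianLaw_causal_sum (h : IsProcess P ξ Y ε) (T N : ℕ) :
    HasGaussianLaw (fun ω (k : Fin T) => ∑ j ∈ Finset.range N,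
        ξ.Phi ^ j *ᵥ (ε ((k : ℤ) + 1 - j) ω + ξ.Theta *ᵥ ε ((k : ℤ) + 1 - j - 1) ω)) P := by
  -- A finite window containing every noise time that occurs in the sums for `k < T`, `j < N`.
  -- Independent Gaussian vectors over it are jointly Gaussian, and the sums are a linear image.
  let I : Finset ℤ := Finset.Icc (-(N : ℤ)) (T : ℤ)
  have hG : HasGaussianLaw (fun ω (s : I) => ε s ω) P :=
    (h.indep_noise.precomp Subtype.val_injective).hasGaussianLaw fun s => h.hasGaussianLaw_noise s
  let e : ℤ → (I → Fin n → ℝ) →ₗ[ℝ] (Fin n → ℝ) := fun s =>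
    if hs : s ∈ I then LinearMap.proj (⟨s, hs⟩ : I) else 0
  have he : ∀ s ∈ I, ∀ ω, e s (fun s => ε s ω) = ε s ω := by
    intro s hs ω
    simp only [e, dif_pos hs]
    rfl
  let L : (I → Fin n → ℝ) →ₗ[ℝ] Data n T := LinearMap.pi fun k => ∑ j ∈ Finset.range N,
    (ξ.Phi ^ j).mulVecLin ∘ₗ
      (e ((k : ℤ) + 1 - j) + ξ.Theta.mulVecLin ∘ₗ e ((k : ℤ) + 1 - j - 1))
  have hL := hG.map_fun L.toContinuousLinearMap
  refine hL.congr (ae_of_all _ fun ω => ?_)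
  funext k
  simp only [L, LinearMap.coe_toContinuousLinearMap', LinearMap.pi_apply, LinearMap.sum_apply,
    LinearMap.comp_apply, LinearMap.add_apply, Matrix.mulVecLin_apply]
  refine Finset.sum_congr rfl fun j hj => ?_
  have hj' := Finset.mem_range.1 hj
  have hk := k.2
  rw [he _ (Finset.mem_Icc.2 ⟨by omega, by omega⟩), he _ (Finset.mem_Icc.2 ⟨by omega, by omega⟩)]

/-- The data set of a causal process is Gaussian. -/
lemma hasGaussianLaw_sample [IsProbabilityMeasure P] (h : IsProcess P ξ Y ε)
    (hc : ξ.CausalInvertible) (T : ℕ) : HasGaussianLaw (sample T Y) P := by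
  refine hasGaussianLaw_pi_of_tendsto_eLpNorm (fun N => h.hasGaussianLaw_causal_sum T N)
    (h.measurable_sample T) (fun t i => h.sqInt _ i) fun k i => ?_
  -- The error is the remainder `Φ^N Y_{t-N}`; by stationarity its mean-square size depends on `N`
  -- only through `Φ^N`.
  have hrem : ∀ N : ℕ, eLpNorm (fun ω => (∑ j ∈ Finset.range N, ξ.Phi ^ j *ᵥ
      (ε ((k : ℤ) + 1 - j) ω + ξ.Theta *ᵥ ε ((k : ℤ) + 1 - j - 1) ω)) i - sample T Y ω k i) 2 P =
      ENNReal.ofReal (Real.sqrt ((ξ.Phi ^ N * cross P (Y 0) (Y 0) * (ξ.Phi ^ N)ᵀ) i i)) := by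
    intro N
    have hsq := (h.sqInt ((k : ℤ) + 1 - N)).mulVec (ξ.Phi ^ N)
    have hae : (fun ω => (∑ j ∈ Finset.range N, ξ.Phi ^ j *ᵥ
        (ε ((k : ℤ) + 1 - j) ω + ξ.Theta *ᵥ ε ((k : ℤ) + 1 - j - 1) ω)) i - sample T Y ω k i)
        =ᵐ[P] -(fun ω => (ξ.Phi ^ N *ᵥ Y ((k : ℤ) + 1 - N) ω) i) := by
      filter_upwards [h.ae_eq_causal_sum N ((k : ℤ) + 1)] with ω hω
      rw [sample, hω, Pi.add_apply, Pi.neg_apply]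
      ring
    have hsh := h.cross_shift ((k : ℤ) + 1 - N) 0 0
    simp only [add_zero] at hsh
    rw [eLpNorm_congr_ae hae, eLpNorm_neg, eLpNorm_two_eq (hsq i), ← hsh,
      ← cross_mulVec_left (h.sqInt _) (h.sqInt _), ← cross_mulVec_right hsq (h.sqInt _)]
    rfl
  simp_rw [hrem]
  have h0 := tendsto_pow_matrix hc.tendsto_pow
  have h0T : Tendsto (fun N => (ξ.Phi ^ N)ᵀ) atTop (𝓝 0) := by
    have := (continuous_id.matrix_transpose.tendsto (0 : Matrix (Fin n) (Fin n) ℝ)).comp h0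
    rwa [Function.comp_def, id, Matrix.transpose_zero] at this
  have h1 := (h0.mul_const (cross P (Y 0) (Y 0))).mul h0T
  rw [Matrix.mul_zero] at h1
  have h2 := tendsto_pi_nhds.1 (tendsto_pi_nhds.1 h1 i) i
  have h3 := ENNReal.tendsto_ofReal ((Real.continuous_sqrt.tendsto _).comp h2)
  simpa [Function.comp_def] using h3

end Sample

/-! ### Symmetry of the autocovariances -/

section Symmetric

/-- The autocovariance at a lag in `ℕ` is symmetric. -/
lemma autocov_symm (h : IsProcess P ξ Y ε) (hξ : ξ.Admissible) (k : ℕ) :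
    (cross P (Y k) (Y 0))ᵀ = cross P (Y k) (Y 0) := by
  have hc := hξ.causalInvertible
  have hS := hξ.posDef.posSemidef
  have hST : ξ.SigmaEpsᵀ = ξ.SigmaEps := by simpa using hS.isHermitian.eq
  rcases k with _ | k
  · simp [cross_transpose]
  · have hpow : ∀ k : ℕ, cross P (Y ((k : ℤ) + 1)) (Y 0) = ξ.Phi ^ k * cross P (Y 1) (Y 0) := by
      intro k
      induction k with
      | zero => simp
      | succ k ih =>
        rw [pow_succ', Matrix.mul_assoc, ← ih, ← h.cross_add_two hc, Nat.cast_succ, add_assoc]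
        rfl
    have h1' := congrArg Matrix.transpose (h.cross_one hc hS)
    rw [transpose_sub, transpose_mul, transpose_mul, hST, cross_transpose (Y 0) (Y 0)] at h1'
    rw [Nat.cast_succ, hpow]
    exact hξ.symmetricCovariance.pow_mul_symm hc (h.cross_difference hS) (h.cross_one hc hS) h1' k

/-- Swapping the two times transposes the matrix, which symmetry undoes; so only the absolute lag
matters. -/
lemma cross_eq_autocov (h : IsProcess P ξ Y ε) (hξ : ξ.Admissible) {s t : ℤ} {k : ℕ}
    (hk : t = s + k ∨ s = t + k) : cross P (Y s) (Y t) = cross P (Y k) (Y 0) := by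
  have hsh : ∀ s : ℤ, cross P (Y (s + k)) (Y s) = cross P (Y k) (Y 0) := fun s => by
    have := h.cross_shift s 0 k
    rwa [zero_add] at this
  rcases hk with rfl | rfl
  · rw [← cross_transpose, hsh, h.autocov_symm hξ]
  · exact hsh t

end Symmetric

/-! ### The forward process has the covariance of an MA(1), up to its last term -/

section Forward

variable {T : ℕ}

omit [MeasurableSpace Ω] in
lemma obs_sample (Y : ℤ → Ω → Fin n → ℝ) (ω : Ω) {t : ℕ} (ht : 1 ≤ t ∧ t ≤ T) :
    obs (sample T Y ω) t = Y t ω := by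
  rw [obs, dif_pos ht, sample]
  congr 1
  push_cast [ht.1]
  ring

omit [MeasurableSpace Ω] in
lemma forward_sample_of_lt (Y : ℤ → Ω → Fin n → ℝ) {t : ℕ} (ht1 : 1 ≤ t) (ht : t < T) :
    (fun ω => forward ξ (sample T Y ω) t) = fun ω => Y t ω - ξ.Phi *ᵥ Y ((t : ℤ) + 1) ω := by
  funext ω
  rw [forward, if_pos ht, obs_sample Y ω ⟨ht1, ht.le⟩, obs_sample Y ω ⟨by omega, ht⟩]
  norm_cast

omit [MeasurableSpace Ω] in
lemma forward_sample_last (Y : ℤ → Ω → Fin n → ℝ) (hT : 1 ≤ T) :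
    (fun ω => forward ξ (sample T Y ω) T) = Y T := by
  funext ω
  rw [forward, if_neg (lt_irrefl _), obs_sample Y ω ⟨hT, le_rfl⟩]

lemma sqInt_forward (h : IsProcess P ξ Y ε) {t : ℕ} (ht1 : 1 ≤ t) (ht : t ≤ T) :
    SqInt P fun ω => forward ξ (sample T Y ω) t := by
  rcases ht.lt_or_eq with hlt | rfl
  · rw [forward_sample_of_lt Y ht1 hlt]
    exact (h.sqInt _).sub ((h.sqInt _).mulVec _)
  · rw [forward_sample_last Y ht1]
    exact h.sqInt _

/-- The transpose of `cross_one`. Symmetry of `Γ(1)` is what allows `Φᵀ` to act on the right, as the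
covariance with `ΦY_{s+1}` requires. -/
lemma autocov_one (h : IsProcess P ξ Y ε) (hξ : ξ.Admissible) :
    cross P (Y 1) (Y 0) = cross P (Y 0) (Y 0) * ξ.Phiᵀ + ξ.SigmaEps * ξ.Thetaᵀ := by
  have hS := hξ.posDef.posSemidef
  have hST : ξ.SigmaEpsᵀ = ξ.SigmaEps := by simpa using hS.isHermitian.eq
  have h1' := congrArg Matrix.transpose (h.cross_one hξ.causalInvertible hS)
  rw [transpose_sub, transpose_mul, transpose_mul, hST, cross_transpose (Y 0) (Y 0)] at h1'
  have := h.autocov_symm hξ 1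
  rw [Nat.cast_one] at this
  rw [this] at h1'
  rw [← h1', add_sub_cancel]

lemma autocov_add_two (h : IsProcess P ξ Y ε) (hξ : ξ.Admissible) (k : ℕ) :
    cross P (Y ((k + 2 : ℕ) : ℤ)) (Y 0) = cross P (Y ((k + 1 : ℕ) : ℤ)) (Y 0) * ξ.Phiᵀ := by
  rw [← h.autocov_symm hξ (k + 2)]
  conv_rhs => rw [← h.autocov_symm hξ (k + 1), ← transpose_mul]
  push_cast
  rw [h.cross_add_two hξ.causalInvertible]

/-- The process is correlated with the forward process at the preceding time only. -/
lemma cross_forward (h : IsProcess P ξ Y ε) (hξ : ξ.Admissible) {s : ℕ} (hs1 : 1 ≤ s)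
    (hs : s < T) {t : ℕ} (hst : s < t) :
    cross P (Y t) (fun ω => forward ξ (sample T Y ω) s) =
      if t = s + 1 then ξ.SigmaEps * ξ.Thetaᵀ else 0 := by
  rw [forward_sample_of_lt Y hs1 hs, cross_sub_right (h.sqInt _) (h.sqInt _)
    ((h.sqInt _).mulVec _), cross_mulVec_right (h.sqInt _) (h.sqInt _)]
  split_ifs with heq
  · subst heq
    have e1 := h.cross_eq_autocov hξ (s := ((s + 1 : ℕ) : ℤ)) (t := s) (k := 1)
      (Or.inr (by push_cast; rfl))
    have e0 := h.cross_eq_autocov hξ (s := ((s + 1 : ℕ) : ℤ)) (t := (s : ℤ) + 1) (k := 0)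
      (Or.inr (by push_cast; ring))
    rw [e1, e0, Nat.cast_one, Nat.cast_zero, h.autocov_one hξ, add_sub_cancel_left]
  · obtain ⟨k, rfl⟩ : ∃ k, t = s + (k + 2) := ⟨t - s - 2, by omega⟩
    have e2 := h.cross_eq_autocov hξ (s := ((s + (k + 2) : ℕ) : ℤ)) (t := s) (k := k + 2)
      (Or.inr (by push_cast; ring))
    have e1 := h.cross_eq_autocov hξ (s := ((s + (k + 2) : ℕ) : ℤ)) (t := (s : ℤ) + 1) (k := k + 1)
      (Or.inr (by push_cast; ring))
    rw [e2, e1, h.autocov_add_two hξ, sub_self]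

/-- For `t < T` the extra term `ΦY_{t+1}` in `W_t` is at least two steps after `s`, hence
uncorrelated with `W_s`. -/
lemma cross_forward_forward (h : IsProcess P ξ Y ε) (hξ : ξ.Admissible) {s t : ℕ} (hs1 : 1 ≤ s)
    (hst : s < t) (ht : t ≤ T) :
    cross P (fun ω => forward ξ (sample T Y ω) t) (fun ω => forward ξ (sample T Y ω) s) =
      if t = s + 1 then ξ.SigmaEps * ξ.Thetaᵀ else 0 := by
  have hW := h.sqInt_forward (T := T) hs1 (by omega)
  rcases ht.lt_or_eq with hlt | rfl
  · have h2 := h.cross_forward hξ hs1 (by omega : s < T) (by omega : s < t + 1)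
    rw [if_neg (by omega)] at h2
    push_cast at h2
    rw [forward_sample_of_lt Y (by omega) hlt, cross_sub_left (h.sqInt _) ((h.sqInt _).mulVec _) hW,
      cross_mulVec_left (h.sqInt _) hW, h.cross_forward hξ hs1 (by omega) hst, h2,
      Matrix.mul_zero, sub_zero]
  · rw [forward_sample_last Y (by omega), h.cross_forward hξ hs1 (by omega) hst]

/-- For `t < T`, symmetry of the lag-one autocovariance gives `Y_t - ΦY_{t+1}` the second moment of
`Y_1 - ΦY_0`. -/
lemma cross_forward_self (h : IsProcess P ξ Y ε) (hξ : ξ.Admissible) {t : ℕ} (ht1 : 1 ≤ t)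
    (ht : t ≤ T) :
    cross P (fun ω => forward ξ (sample T Y ω) t) (fun ω => forward ξ (sample T Y ω) t) =
      if t = T then ξ.gammaY else ξ.Theta * ξ.SigmaEps * ξ.Thetaᵀ + ξ.SigmaEps := by
  have hS := hξ.posDef.posSemidef
  split_ifs with hT
  · subst hT
    rw [forward_sample_last Y ht1, h.cross_eq_autocov hξ (k := 0) (Or.inr (by simp)),
      Nat.cast_zero, h.cross_zero_eq_gammaY hξ.causalInvertible hS]
  · have hlt : t < T := by omega
    have hY := h.sqInt
    rw [forward_sample_of_lt Y ht1 hlt, cross_sub_left (hY _) ((hY _).mulVec _)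
      ((hY _).sub ((hY _).mulVec _)), cross_mulVec_left (hY _) ((hY _).sub ((hY _).mulVec _)),
      cross_sub_right (hY _) (hY _) ((hY _).mulVec _),
      cross_sub_right (hY _) (hY _) ((hY _).mulVec _), cross_mulVec_right (hY _) (hY _),
      cross_mulVec_right (hY _) (hY _),
      h.cross_eq_autocov hξ (k := 0) (Or.inr (by simp) : (t : ℤ) = t + (0 : ℕ) ∨ _),
      h.cross_eq_autocov hξ (k := 1) (Or.inl (by simp) : (t : ℤ) + 1 = t + (1 : ℕ) ∨ _),
      h.cross_eq_autocov hξ (k := 1) (Or.inr (by simp) : _ ∨ (t : ℤ) + 1 = t + (1 : ℕ)),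
      h.cross_eq_autocov hξ (k := 0) (Or.inr (by simp) : _ ∨ (t : ℤ) + 1 = t + 1 + (0 : ℕ)),
      Nat.cast_zero, Nat.cast_one, add_comm _ ξ.SigmaEps, ← h.cross_difference hS]
    have := h.autocov_symm hξ 1
    rw [Nat.cast_one] at this
    rw [this, Matrix.mul_sub, ← Matrix.mul_assoc]
    abel

end Forward

/-! ### Orthogonality and covariance of the innovations -/

section Innovations

variable {T : ℕ}

lemma sqInt_innov (h : IsProcess P ξ Y ε) (hT : 2 ≤ T) {t : ℕ} (ht1 : 1 ≤ t) (ht : t ≤ T) :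
    SqInt P fun ω => innov ξ (sample T Y ω) t := by
  induction t, ht1 using Nat.le_induction with
  | base => simpa only [innov_one ξ _ hT] using h.sqInt_forward le_rfl (by omega)
  | succ t ht1 ih =>
    simp only [innov_succ ξ _ ht1 ht]
    exact (h.sqInt_forward (by omega) ht).sub ((ih (by omega)).mulVec _)

lemma predCov_posDef (h : IsProcess P ξ Y ε) (hξ : ξ.Admissible) (hT : 2 ≤ T) {t : ℕ}
    (ht1 : 1 ≤ t) (ht : t ≤ T) : (ξ.predCov T t).PosDef :=
  ξ.predCov_posDef hξ.posDef (h.gammaY_sub_posSemidef hξ.causalInvertible hξ.posDef.posSemidef)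
    hT ht1 ht

/-- The second moments of the innovations and the forward process. -/
lemma cross_innov (h : IsProcess P ξ Y ε) (hξ : ξ.Admissible) (hT : 2 ≤ T) {t : ℕ}
    (ht1 : 1 ≤ t) (ht : t ≤ T) :
    (∀ s, 1 ≤ s → s < t → cross P (fun ω => innov ξ (sample T Y ω) t)
      (fun ω => forward ξ (sample T Y ω) s) = 0) ∧
    (∀ u, t < u → u ≤ T → cross P (fun ω => forward ξ (sample T Y ω) u)
      (fun ω => innov ξ (sample T Y ω) t) = if u = t + 1 then ξ.SigmaEps * ξ.Thetaᵀ else 0) ∧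
    cross P (fun ω => innov ξ (sample T Y ω) t) (fun ω => forward ξ (sample T Y ω) t) =
      ξ.predCov T t ∧
    cross P (fun ω => innov ξ (sample T Y ω) t) (fun ω => innov ξ (sample T Y ω) t) =
      ξ.predCov T t := by
  have hS := hξ.posDef.posSemidef
  have hST : ξ.SigmaEpsᵀ = ξ.SigmaEps := by simpa using hS.isHermitian.eq
  -- The four claims are proved together: orthogonality of `R_{t+1}` to `W_t` uses `E[R_t W_tᵀ] =
  -- Σ_t` and `Θ_{t,1}Σ_t = Σ_εΘᵀ`, while `Σ_{t+1}` comes from the correlation of `W_{t+1}` with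
  -- `R_t`.
  induction t, ht1 using Nat.le_induction with
  | base =>
    simp only [innov_one ξ _ hT]
    have hself := h.cross_forward_self hξ (T := T) le_rfl (by omega)
    rw [if_neg (by omega)] at hself
    exact ⟨fun s hs hs' => by omega, fun u hu huT => h.cross_forward_forward hξ le_rfl hu huT,
      hself, hself⟩
  | succ t ht1 ih =>
    obtain ⟨i1, i2, i3, i4⟩ := ih (by omega)
    have hpos := h.predCov_posDef hξ hT ht1 (by omega)
    have hcoef := ξ.coef_mul_predCov hpos
    have hR := h.sqInt_innov hT ht1 (by omega)
    have hcR := hR.mulVec (ξ.coef T t)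
    have hW : ∀ {s}, 1 ≤ s → s ≤ T → SqInt P fun ω => forward ξ (sample T Y ω) s :=
      fun h1 h2 => h.sqInt_forward h1 h2
    have hR' := h.sqInt_innov hT (by omega) ht
    have hleft : ∀ {Z : Ω → Fin n → ℝ}, SqInt P Z →
        cross P (fun ω => innov ξ (sample T Y ω) (t + 1)) Z =
          cross P (fun ω => forward ξ (sample T Y ω) (t + 1)) Z -
            ξ.coef T t * cross P (fun ω => innov ξ (sample T Y ω) t) Z := by
      intro Z hZ
      simp only [innov_succ ξ _ ht1 ht]
      rw [cross_sub_left (hW (by omega) ht) hcR hZ, cross_mulVec_left hR hZ]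
    have hright : ∀ {Z : Ω → Fin n → ℝ}, SqInt P Z →
        cross P Z (fun ω => innov ξ (sample T Y ω) (t + 1)) =
          cross P Z (fun ω => forward ξ (sample T Y ω) (t + 1)) -
            cross P Z (fun ω => innov ξ (sample T Y ω) t) * (ξ.coef T t)ᵀ := by
      intro Z hZ
      simp only [innov_succ ξ _ ht1 ht]
      rw [cross_sub_right hZ (hW (by omega) ht) hcR, cross_mulVec_right hZ hR]
    have hnext := i2 (t + 1) (by omega) ht
    rw [if_pos rfl] at hnext
    have hnextT : cross P (fun ω => innov ξ (sample T Y ω) t)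
        (fun ω => forward ξ (sample T Y ω) (t + 1)) = ξ.Theta * ξ.SigmaEps := by
      rw [← cross_transpose, hnext, transpose_mul, transpose_transpose, hST]
    have hRW : cross P (fun ω => innov ξ (sample T Y ω) (t + 1))
        (fun ω => forward ξ (sample T Y ω) (t + 1)) = ξ.predCov T (t + 1) := by
      rw [hleft (hW (by omega) ht), h.cross_forward_self hξ (by omega) ht, hnextT]
      obtain ⟨s, rfl⟩ : ∃ s, t = s + 1 := ⟨t - 1, by omega⟩
      rw [ξ.predCov_succ_succ, ξ.coef_mul_predCov_mul_coef hST hpos]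
      rfl
    -- The coefficient `Θ_{t,1}` is the one that makes this difference vanish.
    have hRR : cross P (fun ω => innov ξ (sample T Y ω) (t + 1))
        (fun ω => innov ξ (sample T Y ω) t) = 0 := by
      rw [hleft hR, hnext, i4, hcoef, sub_self]
    refine ⟨fun s hs hst => ?_, fun u hu huT => ?_, hRW, ?_⟩
    · rw [hleft (hW hs (by omega)), h.cross_forward_forward hξ hs hst ht]
      rcases (Nat.lt_succ_iff.1 hst).lt_or_eq with hlt | rfl
      · rw [if_neg (by omega), i1 s hs hlt, Matrix.mul_zero, sub_zero]
      · rw [if_pos rfl, i3, hcoef, sub_self]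
    · rw [hright (hW (by omega) huT), h.cross_forward_forward hξ (by omega) hu huT,
        i2 u (by omega) huT, if_neg (by omega : ¬ u = t + 1), Matrix.zero_mul, sub_zero]
    · rw [hright hR', hRW, hRR, Matrix.zero_mul, sub_zero]

end Innovations

end IsProcess

section Span

variable {n T : ℕ}

/-- The innovations differ from the forward process by a linear combination of its past. -/
lemma exists_innov_eq_forward_add (ξ : Param n) (hT : 2 ≤ T) {t : ℕ} (ht1 : 1 ≤ t) (ht : t ≤ T) :
    ∃ A : ℕ → Matrix (Fin n) (Fin n) ℝ, ∀ y : Data n T,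
      innov ξ y t = forward ξ y t + ∑ s ∈ Finset.Ico 1 t, A s *ᵥ forward ξ y s := by
  induction t, ht1 using Nat.le_induction with
  | base => exact ⟨0, fun y => by simp [innov_one ξ y hT]⟩
  | succ t ht1 ih =>
    obtain ⟨A, hA⟩ := ih (by omega)
    refine ⟨fun s => -(ξ.coef T t * if s = t then 1 else A s), fun y => ?_⟩
    have hsum : ∑ s ∈ Finset.Ico 1 t, -(ξ.coef T t * if s = t then 1 else A s) *ᵥ forward ξ y s =
        -(ξ.coef T t *ᵥ ∑ s ∈ Finset.Ico 1 t, A s *ᵥ forward ξ y s) := by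
      rw [Matrix.mulVec_sum, ← Finset.sum_neg_distrib]
      refine Finset.sum_congr rfl fun s hs => ?_
      rw [if_neg (Finset.mem_Ico.1 hs).2.ne, Matrix.neg_mulVec, Matrix.mulVec_mulVec]
    rw [innov_succ ξ y ht1 ht, hA y, Finset.sum_Ico_succ_top ht1, hsum, Matrix.mulVec_add]
    simp only [if_true, Matrix.mul_one, Matrix.neg_mulVec]
    abel

end Span

end VARMA

namespace VARMA

/-! ### The joint law of the innovations and the likelihood -/

section Products

open Finset in
lemma prod_Icc_one_eq_prod_fin {M : Type*} [CommMonoid M] (T : ℕ) (f : ℕ → M) :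
    ∏ t ∈ Icc 1 T, f t = ∏ k : Fin T, f ((k : ℕ) + 1) := by
  rw [← Finset.prod_range fun k => f (k + 1), Finset.range_eq_Ico,
    Finset.prod_Ico_add' f 0 T 1]
  rfl

lemma prod_gaussDensity {n T : ℕ} {S : ℕ → Matrix (Fin n) (Fin n) ℝ}
    (hS : ∀ t ∈ Finset.Icc 1 T, (S t).PosDef) (r : ℕ → Fin n → ℝ) :
    ∏ k : Fin T, gaussDensity (S ((k : ℕ) + 1)) (r ((k : ℕ) + 1)) =
      (2 * Real.pi) ^ (-((n : ℝ) * (T : ℝ) / 2)) *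
        ((∏ t ∈ Finset.Icc 1 T, (S t).det) ^ (-(1 / 2) : ℝ) *
          Real.exp (-((∑ t ∈ Finset.Icc 1 T, r t ⬝ᵥ ((S t)⁻¹ *ᵥ r t)) / 2))) := by
  rw [← prod_Icc_one_eq_prod_fin T fun t => gaussDensity (S t) (r t)]
  simp only [gaussDensity, Finset.prod_mul_distrib, Finset.prod_const, Nat.card_Icc,
    Nat.add_sub_cancel]
  rw [Real.finsetProd_rpow _ _ fun t ht => (hS t ht).det_pos.le, ← Real.exp_sum,
    ← Real.rpow_natCast, ← Real.rpow_mul (by positivity), mul_assoc, Finset.sum_neg_distrib,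
    Finset.sum_div]
  congr 2
  ring

end Products

lemma measurable_stat (n T : ℕ) : Measurable (stat : Data n T → Stat n T) := by
  unfold stat
  fun_prop

namespace IsProcess

variable {n T : ℕ} {Ω : Type u} [MeasurableSpace Ω] {P : Measure Ω}
  {ξ : Param n} {Y ε : ℤ → Ω → Fin n → ℝ}

lemma integral_linearMap_sample [IsProbabilityMeasure P] (h : IsProcess P ξ Y ε) (L : Data n T →ₗ[ℝ] (Fin n → ℝ))
    (i : Fin n) : ∫ ω, L (sample T Y ω) i ∂P = 0 := by
  have hL : ∀ y : Data n T, L y i = ∑ t, ∑ j, y t j * L (Pi.single t (Pi.single j 1)) i := by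
    intro y
    conv_lhs => rw [eq_sum_smul_single y]
    simp only [map_sum, map_smul, Finset.sum_apply, Pi.smul_apply, smul_eq_mul]
  have hint : ∀ (t : Fin T) (j : Fin n), Integrable
      (fun ω => sample T Y ω t j * L (Pi.single t (Pi.single j 1)) i) P := fun t j =>
    ((h.sqInt _ j).integrable (by norm_num)).mul_const _
  rw [integral_congr_ae (ae_of_all _ fun ω => hL (sample T Y ω)),
    integral_finsetSum _ fun t _ => integrable_finsetSum _ fun j _ => hint t j]
  refine Finset.sum_eq_zero fun t _ => ?_
  rw [integral_finsetSum _ fun j _ => hint t j]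
  refine Finset.sum_eq_zero fun j _ => ?_
  rw [integral_mul_const]
  have : ∫ ω, sample T Y ω t j ∂P = 0 := h.mean_zero _ j
  rw [this, zero_mul]

lemma integral_innov [IsProbabilityMeasure P] (h : IsProcess P ξ Y ε) (hT : 2 ≤ T) {t : ℕ} (ht1 : 1 ≤ t) (ht : t ≤ T)
    (i : Fin n) : ∫ ω, innov ξ (sample T Y ω) t i ∂P = 0 := by
  have := h.integral_linearMap_sample (innovLin ξ T t) i
  simpa only [innovLin_apply ξ hT _ ht1 ht] using this

/-- `R_s` is a combination of `W_1, …, W_s`, all of them orthogonal to `R_t`. -/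
lemma cross_innov_of_lt (h : IsProcess P ξ Y ε) (hξ : ξ.Admissible) (hT : 2 ≤ T) {s t : ℕ}
    (hs1 : 1 ≤ s) (hst : s < t) (ht : t ≤ T) :
    cross P (fun ω => innov ξ (sample T Y ω) t) (fun ω => innov ξ (sample T Y ω) s) = 0 := by
  obtain ⟨A, hA⟩ := exists_innov_eq_forward_add (n := n) ξ hT hs1 (by omega : s ≤ T)
  have hR := h.sqInt_innov hT (by omega : 1 ≤ t) ht
  have hW : ∀ r ∈ Finset.Ico 1 s, SqInt P fun ω => A r *ᵥ forward ξ (sample T Y ω) r :=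
    fun r hr => (h.sqInt_forward (Finset.mem_Ico.1 hr).1
      (by have := (Finset.mem_Ico.1 hr).2; omega)).mulVec _
  have hzero := (h.cross_innov hξ hT (by omega : 1 ≤ t) ht).1
  simp only [hA]
  rw [cross_add_right hR (h.sqInt_forward hs1 (by omega)) (SqInt.sum hW), hzero s hs1 hst,
    cross_sum_right hR hW, zero_add]
  refine Finset.sum_eq_zero fun r hr => ?_
  obtain ⟨hr1, hrs⟩ := Finset.mem_Ico.1 hr
  rw [cross_mulVec_right hR (h.sqInt_forward hr1 (by omega)), hzero r hr1 (by omega),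
    Matrix.zero_mul]

/-- The joint law of the innovations. -/
lemma map_innovMap [IsProbabilityMeasure P] (h : IsProcess P ξ Y ε) (hξ : ξ.Admissible) (hT : 2 ≤ T) :
    P.map (fun ω => innovMap ξ T (sample T Y ω)) = (volume : Measure (Data n T)).withDensity
      fun r => ENNReal.ofReal (∏ k : Fin T, gaussDensity (ξ.predCov T ((k : ℕ) + 1)) (r k)) := by
  have hpos : ∀ k : Fin T, (ξ.predCov T ((k : ℕ) + 1)).PosDef := fun k =>
    h.predCov_posDef hξ hT (by omega) (by omega)
  let R : Fin T → Ω → Fin n → ℝ := fun k ω => innov ξ (sample T Y ω) ((k : ℕ) + 1)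
  have hReq : (fun ω => innovMap ξ T (sample T Y ω)) = fun ω k => R k ω := by
    funext ω k
    exact innovMap_apply ξ hT _ k
  have hG : HasGaussianLaw (fun ω k => R k ω) P := by
    rw [← hReq]
    exact (h.hasGaussianLaw_sample hξ.causalInvertible T).map_fun
      (innovMap ξ T).toContinuousLinearMap
  have hsq : ∀ k, SqInt P (R k) := fun k => h.sqInt_innov hT (by omega) (by omega)
  have hmean : ∀ k i, ∫ ω, R k ω i ∂P = 0 := fun k i =>
    h.integral_innov hT (by omega) (by omega) i
  -- Jointly Gaussian vectors that are uncorrelated are independent.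
  have hind : iIndepFun R P := by
    refine HasGaussianLaw.iIndepFun_of_covariance_eval (X := fun k i ω => R k ω i) hG ?_
    intro k l hkl i j
    have hcross : cross P (R k) (R l) = 0 := by
      rcases lt_or_gt_of_ne hkl with hlt | hlt
      · have h2 : (k : ℕ) < l := hlt
        rw [← cross_transpose, h.cross_innov_of_lt hξ hT (by omega) (by omega) (by omega),
          transpose_zero]
      · have h2 : (l : ℕ) < k := hlt
        exact h.cross_innov_of_lt hξ hT (by omega) (by omega) (by omega)
    rw [covariance_eq_sub (hsq k i) (hsq l j), hmean, zero_mul, sub_zero]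
    exact congrFun (congrFun hcross i) j
  have hRk : ∀ k, P.map (R k) = volume.withDensity fun x =>
      ENNReal.ofReal (gaussDensity (ξ.predCov T ((k : ℕ) + 1)) x) := fun k => by
    rw [← map_multivariateGaussian_eq_withDensity (hpos k)]
    exact map_eq_map_multivariateGaussian (hG.map_fun (ContinuousLinearMap.proj k)) (hmean k)
      (hpos k).posSemidef (h.cross_innov hξ hT (by omega) (by omega)).2.2.2
  have hRm : ∀ k, AEMeasurable (R k) P := fun k =>
    (hG.map_fun (ContinuousLinearMap.proj k)).aemeasurable
  rw [hReq, (iIndepFun_iff_map_fun_eq_pi_map hRm).1 hind]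
  simp_rw [hRk]
  exact pi_withDensity_ofReal _ (fun k => integrable_gaussDensity (hpos k))
    (fun k x => (gaussDensity_pos (hpos k) x).le)

/-- The likelihood of the data. -/
lemma map_sample [IsProbabilityMeasure P] (h : IsProcess P ξ Y ε) (hξ : ξ.Admissible) (hT : 2 ≤ T) :
    P.map (sample T Y) = (volume : Measure (Data n T)).withDensity fun y =>
      ENNReal.ofReal ((2 * Real.pi) ^ (-((n : ℝ) * (T : ℝ) / 2)) *
        ((∏ t ∈ Finset.Icc 1 T, (ξ.predCov T t).det) ^ (-(1 / 2) : ℝ) *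
          Real.exp (-((∑ t ∈ Finset.Icc 1 T,
            innov ξ y t ⬝ᵥ ((ξ.predCov T t)⁻¹ *ᵥ innov ξ y t)) / 2)))) := by
  have hdet : LinearMap.det (innovMap (n := n) ξ T) ≠ 0 := by
    rw [det_innovMap ξ hT]
    exact one_ne_zero
  let e : Data n T ≃ₗ[ℝ] Data n T := (innovMap ξ T).equivOfDetNeZero hdet
  have he : ∀ y, e y = innovMap ξ T y := fun y => rfl
  have hsymm : ∀ y, e.symm (innovMap ξ T y) = y := fun y => by rw [← he, e.symm_apply_apply]
  have hinv : ∀ r, innovMap ξ T (e.symm r) = r := fun r => by rw [← he, e.apply_symm_apply]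
  -- Pulling the law of the innovations back to the data costs no Jacobian factor.
  have hdet' : LinearMap.det (e.symm : Data n T →ₗ[ℝ] Data n T) = 1 := by
    have hc : (e.symm : Data n T →ₗ[ℝ] Data n T) ∘ₗ innovMap ξ T = LinearMap.id :=
      LinearMap.ext hsymm
    have := congrArg LinearMap.det hc
    rwa [LinearMap.det_comp, det_innovMap ξ hT, mul_one, LinearMap.det_id] at this
  have hm : Measurable (innovMap (n := n) ξ T) :=
    (LinearMap.continuous_of_finiteDimensional _).measurable
  have hms : Measurable (e.symm : Data n T →ₗ[ℝ] Data n T) :=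
    (LinearMap.continuous_of_finiteDimensional _).measurable
  have hmap : P.map (sample T Y) = (P.map fun ω => innovMap ξ T (sample T Y ω)).map
      (e.symm : Data n T →ₗ[ℝ] Data n T) := by
    rw [Measure.map_map hms (show Measurable fun ω => innovMap ξ T (sample T Y ω) from
      hm.comp (h.measurable_sample T))]
    congr 1
    funext ω
    exact (hsymm _).symm
  have hdens : Measurable fun r : Data n T =>
      ENNReal.ofReal (∏ k : Fin T, gaussDensity (ξ.predCov T ((k : ℕ) + 1)) (r k)) :=
    Measurable.ennreal_ofReal (Finset.measurable_prod _ fun k _ =>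
      (continuous_gaussDensity _).measurable.comp (measurable_pi_apply k))
  rw [hmap, h.map_innovMap hξ hT, map_withDensity_linearMap volume
    (e.symm : Data n T →ₗ[ℝ] Data n T) (innovMap ξ T) hinv hdens, hdet', inv_one, abs_one,
    ENNReal.ofReal_one, one_smul]
  congr 1
  funext y
  rw [← prod_gaussDensity (fun t ht => h.predCov_posDef hξ hT (Finset.mem_Icc.1 ht).1
    (Finset.mem_Icc.1 ht).2)]
  simp only [innovMap_apply ξ hT]

/-- The predictor is `W_t - R_t`: it lies in the span of the past because `R_t` is `W_t` plus past
terms, and its residual `R_t` is orthogonal to that past. -/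
lemma isOneStepPredictor (h : IsProcess P ξ Y ε) (hξ : ξ.Admissible) (hT : 2 ≤ T) {t : ℕ}
    (ht1 : 1 ≤ t) (ht : t ≤ T) :
    IsOneStepPredictor P (fun s ω => forward ξ (sample T Y ω) s) t
      (fun ω => predictor ξ (sample T Y ω) t) := by
  have hpred : ∀ y : Data n T, forward ξ y t - predictor ξ y t = innov ξ y t := fun y =>
    forward_sub_predictor ξ y hT ht1 ht
  refine ⟨?_, fun s hs i j => ?_⟩
  · obtain ⟨A, hA⟩ := exists_innov_eq_forward_add (n := n) ξ hT ht1 ht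
    refine ⟨fun s => -A s, Filter.EventuallyEq.of_eq (funext fun ω => ?_)⟩
    have h1 := hpred (sample T Y ω)
    rw [hA] at h1
    simp only [Matrix.neg_mulVec, Finset.sum_neg_distrib]
    rw [eq_neg_iff_add_eq_zero]
    have h2 : forward ξ (sample T Y ω) t - predictor ξ (sample T Y ω) t -
        (forward ξ (sample T Y ω) t +
          ∑ s ∈ Finset.Ico 1 t, A s *ᵥ forward ξ (sample T Y ω) s) = 0 := sub_eq_zero.2 h1
    rw [← neg_eq_zero, ← h2]
    abel
  · obtain ⟨hs1, hst⟩ := Finset.mem_Ico.1 hs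
    have := congrFun (congrFun ((h.cross_innov hξ hT ht1 ht).1 s hs1 hst) i) j
    simp only [hpred]
    exact this

end IsProcess

end VARMA

theorem mainTheorem3 (n T : ℕ) (hT : 2 ≤ T) :
    -- the functions `g₁` and `h` of the statistic and the parameter
    ∃ g₁ h : VARMA.Stat n T → VARMA.Param n → ℝ,
      (∀ ξ, Measurable fun s => h s ξ) ∧
      (∀ (ξ : VARMA.Param n) (y : VARMA.Data n T),
        h (VARMA.stat y) ξ =
          ∑ t ∈ Finset.Icc 1 T,
            VARMA.innov ξ y t ⬝ᵥ ((ξ.predCov T t)⁻¹ *ᵥ VARMA.innov ξ y t)) ∧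
      (∀ s ξ, g₁ s ξ =
        (∏ t ∈ Finset.Icc 1 T, (ξ.predCov T t).det) ^ (-(1 / 2) : ℝ) *
          Real.exp (-(h s ξ / 2))) ∧
      -- every process with admissible parameters
      (∀ (ξ : VARMA.Param n), ξ.Admissible →
        ∀ (Ω : Type u) [MeasurableSpace Ω] (P : Measure Ω) [IsProbabilityMeasure P]
          (Y ε : ℤ → Ω → Fin n → ℝ), VARMA.IsProcess P ξ Y ε →
          -- `Γ_Y(0)` is the lag-zero covariance of the process
          (∀ t i j, ∫ ω, Y t ω i * Y t ω j ∂P = ξ.gammaY i j) ∧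
          -- one-step predictors, innovations and their covariances
          (∀ t ∈ Finset.Icc 1 T,
            VARMA.IsOneStepPredictor P
              (fun s ω => VARMA.forward ξ (VARMA.sample T Y ω) s) t
              (fun ω => VARMA.predictor ξ (VARMA.sample T Y ω) t) ∧
            (∀ y : VARMA.Data n T,
              VARMA.forward ξ y t - VARMA.predictor ξ y t = VARMA.innov ξ y t) ∧
            (ξ.predCov T t).PosDef ∧
            ∀ i j, ∫ ω, VARMA.innov ξ (VARMA.sample T Y ω) t i *
              VARMA.innov ξ (VARMA.sample T Y ω) t j ∂P = ξ.predCov T t i j) ∧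
          -- the likelihood of the data is `g₀ g₁`
          P.map (VARMA.sample T Y) = volume.withDensity fun y : VARMA.Data n T =>
            ENNReal.ofReal
              ((2 * Real.pi) ^ (-((n : ℝ) * (T : ℝ) / 2)) * g₁ (VARMA.stat y) ξ)) ∧
      -- sufficiency
      VARMA.IsSufficient (VARMA.model.{u} n T) (VARMA.stat (n := n) (T := T)) := by
  -- `H` is chosen from the parameter alone, before any process is introduced; hence `h` does not
  -- depend on the process.
  choose H hHm hH using fun ξ : VARMA.Param n => VARMA.exists_quadratic_statistic ξ hT
  let g₁ : VARMA.Stat n T → VARMA.Param n → ℝ := fun s ξ =>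
    (∏ t ∈ Finset.Icc 1 T, (ξ.predCov T t).det) ^ (-(1 / 2) : ℝ) * Real.exp (-(H ξ s / 2))
  have hlaw : ∀ (ξ : VARMA.Param n), ξ.Admissible →
      ∀ (Ω : Type u) [MeasurableSpace Ω] (P : Measure Ω) [IsProbabilityMeasure P]
        (Y ε : ℤ → Ω → Fin n → ℝ), VARMA.IsProcess P ξ Y ε →
        P.map (VARMA.sample T Y) = volume.withDensity fun y : VARMA.Data n T =>
          ENNReal.ofReal
            ((2 * Real.pi) ^ (-((n : ℝ) * (T : ℝ) / 2)) * g₁ (VARMA.stat y) ξ) := by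
    intro ξ hξ Ω _ P _ Y ε h
    simp only [g₁, hH]
    exact h.map_sample hξ hT
  refine ⟨g₁, fun s ξ => H ξ s, hHm, hH, fun s ξ => rfl, ?_, ?_⟩
  · intro ξ hξ Ω _ P _ Y ε h
    refine ⟨fun t i j => ?_, fun t ht => ?_, hlaw ξ hξ Ω P Y ε h⟩
    · rw [← h.cross_zero_eq_gammaY hξ.causalInvertible hξ.posDef.posSemidef]
      have := h.stationary t 0 0 i j
      simp only [add_zero] at this
      exact this
    · obtain ⟨ht1, ht2⟩ := Finset.mem_Icc.1 ht
      refine ⟨h.isOneStepPredictor hξ hT ht1 ht2,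
        fun y => VARMA.forward_sub_predictor ξ y hT ht1 ht2, h.predCov_posDef hξ hT ht1 ht2,
        fun i j => ?_⟩
      exact congrFun (congrFun (h.cross_innov hξ hT ht1 ht2).2.2.2 i) j
  -- The constant `(2π)^(-nT/2)` is absorbed into the function of the statistic. Positive
  -- definiteness of every `Σ_t` makes that function nowhere zero, as the criterion demands.
  · refine VARMA.isSufficient_of_factorization volume (VARMA.measurable_stat n T) ?_
    rintro μ ⟨ξ, hξ, Ω, _, P, _, Y, ε, h, rfl⟩
    have hprob : IsProbabilityMeasure (P.map (VARMA.sample T Y)) :=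
      Measure.isProbabilityMeasure_map (h.measurable_sample T).aemeasurable
    have hdet : 0 < ∏ t ∈ Finset.Icc 1 T, (ξ.predCov T t).det := Finset.prod_pos fun t ht =>
      (h.predCov_posDef hξ hT (Finset.mem_Icc.1 ht).1 (Finset.mem_Icc.1 ht).2).det_pos
    have hm := hHm ξ
    refine ⟨inferInstance, fun s => ENNReal.ofReal
      ((2 * Real.pi) ^ (-((n : ℝ) * (T : ℝ) / 2)) * g₁ s ξ), ?_, fun s => ⟨?_, ?_⟩,
      hlaw ξ hξ Ω P Y ε h⟩
    · simp only [g₁]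
      fun_prop
    · rw [ne_eq, ENNReal.ofReal_eq_zero, not_le]
      simp only [g₁]
      positivity
    · exact ENNReal.ofReal_ne_top
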